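/- Let $F$ be a field of characteristic zero; algebras are not assumed associative or unital. Let $m\ge 2$ be an integer and let $w=w_1w_2\dots$ be an infinite word in the alphabet $\{0,1\}$ which is either periodic (for some $T\ge 1$, $w_{i+T}=w_i$ for all $i$) or Sturmian (for every $n\ge 1$ it has exactly $n+1$ distinct subwords of length $n$). Put $k_i=m+w_i$, and let $A=A(m,w)$ be the $F$-algebra with basis $\{a,b\}\cup\{z_j^{(i)} : i\ge 1,\ 1\le j\le k_i\}$ and multiplication $$z_j^{(i)}a=z_{j+1}^{(i)}\ (1\le j<k_i),\qquad z_{k_i}^{(i)}b=z_1^{(i+1)}\qquad (i\ge 1),$$ all other products of basis elements being zero. Let $A=A_0\oplus A_1$ be the $\mathbb{Z}_2$-grading with $z_1^{(1)},a\in A_0$ and $b\in A_1$. Let $A^\#=F\cdot 1\oplus A$ be the algebra obtained from $A$ by adjoining an external unit, with the induced grading $A^\#_0=F\cdot 1\oplus A_0$, $A^\#_1=A_1$. For a $\mathbb{Z}_2$-graded algebra $B=B_0\oplus B_1$, let $P_{k,l}$ be the space of multilinear polynomials in $x_1,\dots,x_k,y_1,\dots,y_l$ in the free nonassociative algebra $F\{X,Y\}$,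 and let $\mathrm{Id}^{gr}(B)$ be the set of polynomials vanishing under all substitutions of elements of $B_0$ for the variables in $X$ and of $B_1$ for the variables in $Y$. Put $$c_{k,l}(B)=\dim_F \frac{P_{k,l}}{P_{k,l}\cap \mathrm{Id}^{gr}(B)},\qquad c_n^{gr}(B)=\sum_{k=0}^n\binom nk c_{k,n-k}(B),\qquad \exp^{gr}(B)=\lim_{n\to\infty}\sqrt[n]{c_n^{gr}(B)}$$ whenever this limit exists (as a finite real number). Then $\exp^{gr}(A)$ and $\exp^{gr}(A^\#)$ both exist, and $$\exp^{gr}(A^\#)=\exp^{gr}(A)+1 .$$ -/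

import Mathlib

open Filter Topology

noncomputable section

/-! ### Infinite binary words -/

/-- The complexity of an infinite binary word `w` (whose letters are `w 0, w 1, …`): the number of
distinct subwords (blocks of consecutive letters) of `w` of length `n`. -/
def wordComplexity (w : ℕ → Fin 2) (n : ℕ) : ℕ :=
  (Set.range fun (i : ℕ) (j : Fin n) => w (i + j)).ncard

/-- An infinite binary word is Sturmian if it has exactly `n + 1` subwords of each length
`n ≥ 1`. -/
def IsSturmian (w : ℕ → Fin 2) : Prop :=
  ∀ n : ℕ, 1 ≤ n → wordComplexity w n = n + 1

/-- An infinite word is periodic if it has some period `T ≥ 1`. -/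
def IsPeriodicWord (w : ℕ → Fin 2) : Prop :=
  ∃ T : ℕ, 1 ≤ T ∧ ∀ i : ℕ, w (i + T) = w i

/-! ### The algebra attached to a word of integers -/

/-- The basis `a, b, z_j^{(i)}` of the algebra `A(K)`. Both indices start from `0` here, so that
`z i j` with `i : ℕ` and `j < K i` stands for the element usually written `z_{j+1}^{(i+1)}`. -/
inductive WordBasis (K : ℕ → ℕ) : Type
  | a : WordBasis K
  | b : WordBasis K
  | z (i : ℕ) (j : Fin (K i)) : WordBasis K

/-- The underlying space of the algebra `A(K)` over `F`: the vector space with basis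
`WordBasis K`. -/
def WordAlgebra (F : Type*) [Field F] (K : ℕ → ℕ) : Type _ := WordBasis K →₀ F

namespace WordAlgebra

variable {F : Type*} [Field F] {K : ℕ → ℕ}

instance : AddCommGroup (WordAlgebra F K) := inferInstanceAs (AddCommGroup (WordBasis K →₀ F))

instance : Module F (WordAlgebra F K) := inferInstanceAs (Module F (WordBasis K →₀ F))

/-- A basis element, as an element of the algebra. -/
def ofBasis (F : Type*) [Field F] {K : ℕ → ℕ} (p : WordBasis K) : WordAlgebra F K :=
  (Finsupp.single p 1 : WordBasis K →₀ F)

/-- The multiplication table: `z_j^{(i)} a = z_{j+1}^{(i)}` unless `z_j^{(i)}` is the last element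
of the `i`-th block; if it is the last one, its product with `b` is the first element of the next
block. All other products are zero. (The condition `0 < K (i + 1)` only says that the next block
is nonempty; it always holds when all `K i ≥ 2`.) -/
def mulTable (F : Type*) [Field F] {K : ℕ → ℕ} : WordBasis K → WordBasis K → WordAlgebra F K
  | .z i j, .a => if h : j.val + 1 < K i then ofBasis F (.z i ⟨j.val + 1, h⟩) else 0
  | .z i j, .b =>
      if h : j.val + 1 = K i ∧ 0 < K (i + 1) then ofBasis F (.z (i + 1) ⟨0, h.2⟩) else 0
  | _, _ => 0

/-- The bilinear extension of the multiplication table. -/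
def mulLin (F : Type*) [Field F] (K : ℕ → ℕ) :
    WordAlgebra F K →ₗ[F] WordAlgebra F K →ₗ[F] WordAlgebra F K :=
  Finsupp.linearCombination F fun p : WordBasis K =>
    (Finsupp.linearCombination F fun q : WordBasis K => mulTable F p q :
      (WordBasis K →₀ F) →ₗ[F] WordAlgebra F K)

instance : Mul (WordAlgebra F K) := ⟨fun x y => mulLin F K x y⟩

instance : NonUnitalNonAssocRing (WordAlgebra F K) :=
  { (inferInstance : AddCommGroup (WordAlgebra F K)),
    (inferInstance : Mul (WordAlgebra F K)) with
    left_distrib := fun x y z => map_add (mulLin F K x) y z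
    right_distrib := fun x y z => LinearMap.map_add₂ (mulLin F K) x y z
    zero_mul := fun x => LinearMap.map_zero₂ (mulLin F K) x
    mul_zero := fun x => map_zero (mulLin F K x) }

instance : IsScalarTower F (WordAlgebra F K) (WordAlgebra F K) :=
  ⟨fun c x y => LinearMap.map_smul₂ (mulLin F K) c x y⟩

instance : SMulCommClass F (WordAlgebra F K) (WordAlgebra F K) :=
  ⟨fun c x y => (map_smul (mulLin F K x) c y).symm⟩

end WordAlgebra

/-- The integers `k_i = m + w_i`. -/
abbrev blockLength (m : ℕ) (w : ℕ → Fin 2) : ℕ → ℕ := fun i => m + (w i).val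

/-- The algebra `A(m, w)`. -/
abbrev BinaryWordAlgebra (F : Type*) [Field F] (m : ℕ) (w : ℕ → Fin 2) : Type _ :=
  WordAlgebra F (blockLength m w)

/-! ### Gradings, and the adjunction of an external unit -/

/-- A `ℤ₂`-grading of a not necessarily associative or unital algebra: a decomposition
`A = A₀ ⊕ A₁` into subspaces with `A_i A_j ⊆ A_{i+j}`. -/
structure IsZ2Grading {F A : Type*} [Field F] [NonUnitalNonAssocRing A] [Module F A]
    (𝒜 : ZMod 2 → Submodule F A) : Prop where
  isInternal : DirectSum.IsInternal 𝒜
  mul_mem : ∀ i j : ZMod 2, ∀ x ∈ 𝒜 i, ∀ y ∈ 𝒜 j, x * y ∈ 𝒜 (i + j)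

section Unit

variable {F A : Type*} [Field F] [NonUnitalNonAssocRing A] [Module F A]

instance Unitization.isScalarTower_nonAssoc [IsScalarTower F A A] :
    IsScalarTower F (Unitization F A) (Unitization F A) :=
  ⟨fun c x y => by
    ext
    · simp [mul_assoc]
    · simp [smul_smul, smul_mul_assoc, smul_add, mul_comm c]⟩

instance Unitization.smulCommClass_nonAssoc [SMulCommClass F A A] :
    SMulCommClass F (Unitization F A) (Unitization F A) :=
  ⟨fun c x y => by
    ext
    · simp [mul_left_comm]
    · simp [smul_smul, mul_smul_comm, smul_add, mul_comm c]⟩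

/-- The grading induced on the algebra `A^# = F·1 ⊕ A` obtained by adjoining an external unit:
`A^#₀ = F·1 ⊕ A₀` and `A^#₁ = A₁`. -/
def unitizationGrading (𝒜 : ZMod 2 → Submodule F A) (i : ZMod 2) :
    Submodule F (Unitization F A) :=
  (𝒜 i).map (Unitization.inrHom F F A) ⊔
    if i = 0 then Submodule.span F {(1 : Unitization F A)} else ⊥

end Unit

/-! ### Graded identities, codimensions and exponents -/

/-- The free nonassociative algebra `F{X, Y}` on the even generators `x_i` (`Sum.inl i`) and the
odd generators `y_i` (`Sum.inr i`). -/
abbrev FreeXY (F : Type*) [Field F] : Type _ := FreeNonUnitalNonAssocAlgebra F (ℕ ⊕ ℕ)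

/-- The generators occurring in a nonassociative monomial, counted with multiplicity. -/
def monomialLetters {X : Type*} : FreeMagma X → Multiset X
  | .of x => {x}
  | .mul s t => monomialLetters s + monomialLetters t

/-- The space `P_{k,l}` of the polynomials that are multilinear in `x_0, …, x_{k-1}` and
`y_0, …, y_{l-1}`: it is spanned by the monomials in which each of these generators occurs exactly
once and no other generator occurs. -/
def multilinearXY (F : Type*) [Field F] (k l : ℕ) : Submodule F (FreeXY F) :=
  Submodule.span F
    (MonoidAlgebra.ofMagma F (FreeMagma (ℕ ⊕ ℕ)) ''
      {t | monomialLetters t =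
        (Multiset.range k).map Sum.inl + (Multiset.range l).map Sum.inr})

section Codim

variable {F A : Type*} [Field F] [NonUnitalNonAssocRing A] [Module F A]
  [IsScalarTower F A A] [SMulCommClass F A A]

/-- The space `Id^{gr}(A)` of the graded identities of `A = A₀ ⊕ A₁`: the polynomials that vanish
under every substitution of elements of `A₀` for the `x_i` and of elements of `A₁` for the
`y_i`. -/
def gradedIdentities (𝒜 : ZMod 2 → Submodule F A) : Submodule F (FreeXY F) where
  carrier := {f | ∀ φ : ℕ ⊕ ℕ → A, (∀ i, φ (Sum.inl i) ∈ 𝒜 0) → (∀ i, φ (Sum.inr i) ∈ 𝒜 1) →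
    FreeNonUnitalNonAssocAlgebra.lift F φ f = 0}
  zero_mem' := fun _ _ _ => map_zero _
  add_mem' := fun hf hg φ h0 h1 => by rw [map_add, hf φ h0 h1, hg φ h0 h1, add_zero]
  smul_mem' := fun c _ hf φ h0 h1 => by rw [map_smul, hf φ h0 h1, smul_zero]

/-- The partial codimension
`c_{k,l}(A) = dim P_{k,l} / (P_{k,l} ∩ Id^{gr}(A))`. -/
def partialCodim (𝒜 : ZMod 2 → Submodule F A) (k l : ℕ) : ℕ :=
  Module.finrank F
    (multilinearXY F k l ⧸ (gradedIdentities 𝒜).comap (multilinearXY F k l).subtype)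

/-- The graded codimension `c_n^{gr}(A) = ∑_{k=0}^n (n choose k) c_{k,n-k}(A)`. -/
def gradedCodim (𝒜 : ZMod 2 → Submodule F A) (n : ℕ) : ℕ :=
  ∑ k ∈ Finset.range (n + 1), n.choose k * partialCodim 𝒜 k (n - k)

/-- The graded PI-exponent `lim_n (c_n^{gr}(A))^{1/n}` exists and is equal to `e`. -/
def HasGradedExponent (𝒜 : ZMod 2 → Submodule F A) (e : ℝ) : Prop :=
  Tendsto (fun n : ℕ => (gradedCodim 𝒜 n : ℝ) ^ (1 / (n : ℝ))) atTop (𝓝 e)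

end Codim

end

/-!
Every product in `A` lies in the span of the `z`'s, and `x z = 0` for all `x` and all such `z`. Hence
`x * y = α(y) (x a) + β(y) (x b)`, where `α` and `β` are the coefficients of `a` and `b`, and only
left-normed monomials survive. Such a monomial, evaluated on `A`, is determined by its first letter
and by the pattern of even and odd letters after it, which has to be a factor of the infinite word
`U = a^{k_1 - 1} b a^{k_2 - 1} b …` (even letters read `a`, odd letters read `b`).

*Upper bounds.* On `A^#` a monomial in the letters `L` is a combination of one term for every set
`S ⊆ L` of letters that do not take multiples of `1`
(`WordAlgebra.gradedEval_mem_span_termSet`). So `c_{k,l}(A)` is at most `T(k, l)` and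
`c_{k,l}(A^#)` is at most `∑ j, (k choose j) T(j, l)` up to the constant term, where `T(j, l)` is
linear in the number of factors of length `j + l - 1`, and vanishes if `l` exceeds the maximal
number `M` of letters `b` in these factors by more than one. The number of factors grows linearly,
since `w` has at most linear complexity.

*Lower bounds.* Left-normed commutators `[x_0, …]` whose letters follow a factor that starts an even
block are not identities of `A`, and they vanish as soon as `1` is put for one of the letters. This
gives `c_{k,l}(A) ≥ 1` and `c_{k,l}(A^#) ≥ (k choose j)`
(`WordAlgebra.choose_le_partialCodim_unitization`).

*Growth.* Let `M_n` be the maximal number of letters `b` in a factor of length `n`. It is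
subadditive, so `M_n / n` tends to some `β`, and `0 < β ≤ 1/2` as all blocks have length between `2`
and `m + 1`; no balance property of Sturmian words is needed. Up to subexponential factors,
`c_n^{gr}(A)` is therefore the largest `n choose l` with `l ≤ M_n`, and its growth rate is
`e = exp (H β)` with the binary entropy `H`. In the same way `c_n^{gr}(A^#)` is
`∑ s, (n choose s) e ^ s = (e + 1) ^ n`, because
`(n choose k) (k choose j) = (n choose s) (s choose l)` for `l = n - k` and `s = j + l`.
-/

/-! ### Words read off from the blocks -/

/-- The word of length `n` read from position `j` of block `i`, where block `i` is
`false ^ (K i - 1), true`. The letter `false` stands for right multiplication by `a` and `true`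
for right multiplication by `b`. From a position `j ≥ K i` outside the block only `false` is
read. -/
def blockWord (K : ℕ → ℕ) : ℕ → ℕ → ℕ → List Bool
  | 0, _, _ => []
  | n + 1, i, j =>
      if j + 1 = K i then true :: blockWord K n (i + 1) 0 else false :: blockWord K n i (j + 1)

section BlockWord

variable {K : ℕ → ℕ}

lemma blockWord_succ (K : ℕ → ℕ) (n i j : ℕ) :
    blockWord K (n + 1) i j =
      if j + 1 = K i then true :: blockWord K n (i + 1) 0 else false :: blockWord K n i (j + 1) :=
  rfl

@[simp] lemma length_blockWord (n i j : ℕ) : (blockWord K n i j).length = n := by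
  induction n generalizing i j with
  | zero => rfl
  | succ n ih => rw [blockWord_succ]; split_ifs <;> simp [ih]

/-- The number of letters `true` in `blockWord K n i j`. -/
def blockCount (K : ℕ → ℕ) (n i j : ℕ) : ℕ := (blockWord K n i j).count true

@[simp] lemma blockCount_zero (i j : ℕ) : blockCount K 0 i j = 0 := rfl

lemma blockCount_succ (n i j : ℕ) :
    blockCount K (n + 1) i j =
      if j + 1 = K i then blockCount K n (i + 1) 0 + 1 else blockCount K n i (j + 1) := by
  unfold blockCount
  rw [blockWord_succ]; split_ifs <;> simp

lemma blockCount_le (n i j : ℕ) : blockCount K n i j ≤ n := by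
  simpa [blockCount] using List.count_le_length (a := true) (l := blockWord K n i j)

lemma blockCount_le_succ (n i j : ℕ) : blockCount K n i j ≤ blockCount K (n + 1) i j := by
  induction n generalizing i j with
  | zero => simp
  | succ n ih =>
    rw [blockCount_succ, blockCount_succ (n + 1)]
    split_ifs
    · exact Nat.succ_le_succ (ih _ _)
    · exact ih _ _

/-- Moving the starting point to the beginning of the next block loses at most one letter
`true`. -/
lemma blockCount_le_next (n i j : ℕ) : blockCount K n i j ≤ blockCount K n (i + 1) 0 + 1 := by
  induction n generalizing i j with
  | zero => simp
  | succ n ih =>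
    have h := blockCount_le_succ (K := K) n (i + 1) 0
    rw [blockCount_succ]
    split_ifs
    · omega
    · exact (ih _ _).trans (by omega)

/-- Every factor can be replaced by one that starts an even block, at the cost of at most two
letters `true`. -/
lemma exists_even_blockCount (n i j : ℕ) :
    ∃ i', Even i' ∧ blockCount K n i j ≤ blockCount K n i' 0 + 2 := by
  rcases Nat.even_or_odd (i + 1) with h | h
  · exact ⟨i + 1, h, (blockCount_le_next n i j).trans (by omega)⟩
  · exact ⟨i + 1 + 1, h.add_one, (blockCount_le_next n i j).trans
      (by have := blockCount_le_next (K := K) n (i + 1) 0; omega)⟩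

/-- If all blocks have length at least two, no two letters `true` are adjacent. -/
lemma two_mul_blockCount_le (hK : ∀ i, 2 ≤ K i) (n : ℕ) :
    ∀ i, (∀ j, 2 * blockCount K n i j ≤ n + 1) ∧ 2 * blockCount K n i 0 ≤ n := by
  induction n with
  | zero => simp
  | succ n ih =>
    refine fun i => ⟨fun j => ?_, ?_⟩
    · rw [blockCount_succ]
      split_ifs
      · have := (ih (i + 1)).2; omega
      · have := (ih i).1 (j + 1); omega
    · rw [blockCount_succ, if_neg (by have := hK i; omega)]
      exact (ih i).1 1

/-- If all blocks have length at most `c`, every `c` consecutive letters contain a `true`. -/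
lemma le_mul_blockCount {c : ℕ} (hK : ∀ i, K i ≤ c) (hK' : ∀ i, 1 ≤ K i) (n i j : ℕ)
    (hj : j < K i) : n + j + 1 ≤ c * blockCount K n i j + c := by
  induction n generalizing i j with
  | zero => have := hK i; simp; omega
  | succ n ih =>
    rw [blockCount_succ]
    split_ifs with h
    · have h1 := ih (i + 1) 0 (hK' _)
      have := hK i
      rw [Nat.mul_add]
      omega
    · have := ih i (j + 1) (by omega)
      omega

lemma exists_blockWord_add (n n' i j : ℕ) :
    ∃ i' j', blockWord K (n + n') i j = blockWord K n i j ++ blockWord K n' i' j' := by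
  induction n generalizing i j with
  | zero => exact ⟨i, j, by simp [blockWord]⟩
  | succ n ih =>
    rw [Nat.add_right_comm]
    simp only [blockWord_succ]
    split_ifs
    · obtain ⟨i', j', h⟩ := ih (i + 1) 0
      exact ⟨i', j', by rw [h]; rfl⟩
    · obtain ⟨i', j', h⟩ := ih i (j + 1)
      exact ⟨i', j', by rw [h]; rfl⟩

/-- The largest number of letters `true` in a word of length `n` read from the blocks. -/
noncomputable def maxBlockCount (K : ℕ → ℕ) (n : ℕ) : ℕ := ⨆ p : ℕ × ℕ, blockCount K n p.1 p.2

lemma bddAbove_blockCount (K : ℕ → ℕ) (n : ℕ) :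
    BddAbove (Set.range fun p : ℕ × ℕ => blockCount K n p.1 p.2) :=
  ⟨n, by rintro _ ⟨p, rfl⟩; exact blockCount_le _ _ _⟩

lemma blockCount_le_max (n i j : ℕ) : blockCount K n i j ≤ maxBlockCount K n :=
  le_ciSup (bddAbove_blockCount K n) (i, j)

lemma exists_blockCount_eq_max (K : ℕ → ℕ) (n : ℕ) :
    ∃ i j, blockCount K n i j = maxBlockCount K n := by
  obtain ⟨p, hp⟩ := Nat.sSup_mem (Set.range_nonempty fun p : ℕ × ℕ => blockCount K n p.1 p.2)
    (bddAbove_blockCount K n)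
  exact ⟨p.1, p.2, hp⟩

lemma maxBlockCount_add_le (K : ℕ → ℕ) (n n' : ℕ) :
    maxBlockCount K (n + n') ≤ maxBlockCount K n + maxBlockCount K n' := by
  refine ciSup_le fun p => ?_
  obtain ⟨i', j', h⟩ := exists_blockWord_add (K := K) n n' p.1 p.2
  have h1 := blockCount_le_max (K := K) n p.1 p.2
  have h2 := blockCount_le_max (K := K) n' i' j'
  unfold blockCount at *
  rw [h, List.count_append]
  omega

lemma maxBlockCount_mono (K : ℕ → ℕ) : Monotone (maxBlockCount K) :=
  monotone_nat_of_le_succ fun n => by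
    obtain ⟨i, j, h⟩ := exists_blockCount_eq_max K n
    rw [← h]
    exact (blockCount_le_succ n i j).trans (blockCount_le_max _ _ _)

/-- The words of length `n` read from a position inside a block. -/
def blockFactors (K : ℕ → ℕ) (n : ℕ) : Set (List Bool) :=
  {u | ∃ i j, j < K i ∧ u = blockWord K n i j}

lemma blockWord_congr {K' : ℕ → ℕ} {n i i' : ℕ} (j : ℕ)
    (h : ∀ d < n, K (i + d) = K' (i' + d)) : blockWord K n i j = blockWord K' n i' j := by
  induction n generalizing i i' j with
  | zero => rfl
  | succ n ih =>
    have h0 : K i = K' i' := h 0 n.succ_pos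
    rw [blockWord_succ, blockWord_succ, h0]
    have h1 : ∀ d < n, K (i + 1 + d) = K' (i' + 1 + d) := fun d hd => by
      simpa [add_assoc, add_comm 1] using h (d + 1) (by omega)
    rw [ih 0 h1, ih (j + 1) fun d hd => h d (by omega)]

/-- A factor is determined by its starting position in a block and by the subword of `w` that
gives the lengths of the blocks it meets. -/
lemma blockFactors_subset (m : ℕ) (w : ℕ → Fin 2) (n : ℕ) :
    blockFactors (blockLength m w) n ⊆
      (fun p : ℕ × (Fin (n + 1) → Fin 2) =>
        blockWord (fun d => if h : d < n + 1 then m + (p.2 ⟨d, h⟩).val else 0) n 0 p.1) ''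
        ((Finset.range (m + 1) : Set ℕ) ×ˢ
          Set.range fun (i : ℕ) (j : Fin (n + 1)) => w (i + j)) := by
  rintro _ ⟨i, j, hj, rfl⟩
  refine ⟨(j, fun d => w (i + d)), ⟨?_, ⟨i, rfl⟩⟩, ?_⟩
  · have := (w i).isLt
    simp only [blockLength] at hj
    simp; omega
  · refine blockWord_congr j fun d hd => ?_
    simp [show d < n + 1 by omega, blockLength]

lemma finite_blockFactors (m : ℕ) (w : ℕ → Fin 2) (n : ℕ) :
    (blockFactors (blockLength m w) n).Finite :=
  (((Finset.finite_toSet _).prod (Set.toFinite _)).image _).subset (blockFactors_subset m w n)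

lemma ncard_blockFactors_le (m : ℕ) (w : ℕ → Fin 2) (n : ℕ) :
    (blockFactors (blockLength m w) n).ncard ≤ (m + 1) * wordComplexity w (n + 1) := by
  have hfin := (Finset.finite_toSet (Finset.range (m + 1))).prod
    (Set.toFinite (Set.range fun (i : ℕ) (j : Fin (n + 1)) => w (i + j)))
  refine (Set.ncard_le_ncard (blockFactors_subset m w n) (hfin.image _)).trans
    ((Set.ncard_image_le hfin).trans ?_)
  rw [Set.ncard_prod, Set.ncard_coe_finset, Finset.card_range, wordComplexity]

lemma wordComplexity_le_of_periodic {w : ℕ → Fin 2} {T : ℕ} (hT : 1 ≤ T)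
    (h : ∀ i, w (i + T) = w i) (n : ℕ) : wordComplexity w n ≤ T := by
  have hmod : ∀ i, w i = w (i % T) := fun i => by
    have hp : Function.Periodic w T := h
    exact (hp.map_mod_nat i).symm
  have hsub : (Set.range fun (i : ℕ) (j : Fin n) => w (i + j)) ⊆
      (fun (i : ℕ) (j : Fin n) => w (i + j)) '' (Finset.range T : Set ℕ) := by
    rintro _ ⟨i, rfl⟩
    refine ⟨i % T, by simpa using Nat.mod_lt i hT, ?_⟩
    funext j
    change w (i % T + j) = w (i + j)
    rw [hmod, hmod (i + j), Nat.mod_add_mod]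
  have hfin := Finset.finite_toSet (Finset.range T)
  refine (Set.ncard_le_ncard hsub (hfin.image _)).trans ((Set.ncard_image_le hfin).trans ?_)
  rw [Set.ncard_coe_finset, Finset.card_range]

/-- The words `w` considered here have at most linearly many subwords, hence so has the word read
from the blocks. -/
lemma exists_ncard_blockFactors_le (m : ℕ) {w : ℕ → Fin 2} (hw : IsSturmian w ∨ IsPeriodicWord w) :
    ∃ C : ℕ, ∀ n, (blockFactors (blockLength m w) n).ncard ≤ C * (n + 1) := by
  rcases hw with hw | ⟨T, hT, hw⟩
  · refine ⟨(m + 1) * 2, fun n => (ncard_blockFactors_le m w n).trans ?_⟩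
    rw [hw (n + 1) (by omega), mul_assoc]
    exact Nat.mul_le_mul_left _ (by omega)
  · refine ⟨(m + 1) * T, fun n => (ncard_blockFactors_le m w n).trans ?_⟩
    refine (Nat.mul_le_mul_left _ (wordComplexity_le_of_periodic hT hw _)).trans ?_
    exact Nat.le_mul_of_pos_right _ n.succ_pos

end BlockWord

/-! ### Graded codimensions as dimensions of spaces of polynomial functions -/

section Codim

variable {F B : Type*} [Field F] [NonUnitalNonAssocRing B] [Module F B]
  [IsScalarTower F B B] [SMulCommClass F B B]

/-- The graded substitutions: even elements for the `x_i`, odd elements for the `y_i`. -/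
abbrev GradedSubst (ℬ : ZMod 2 → Submodule F B) : Type _ :=
  {φ : ℕ ⊕ ℕ → B // (∀ i, φ (Sum.inl i) ∈ ℬ 0) ∧ ∀ i, φ (Sum.inr i) ∈ ℬ 1}

/-- The polynomial function on graded substitutions defined by a polynomial. -/
noncomputable def gradedEval (ℬ : ZMod 2 → Submodule F B) : FreeXY F →ₗ[F] (GradedSubst ℬ → B) :=
  LinearMap.pi fun φ => (FreeNonUnitalNonAssocAlgebra.lift F φ.1 : FreeXY F →ₗ[F] B)

lemma gradedEval_apply (ℬ : ZMod 2 → Submodule F B) (f : FreeXY F) (φ : GradedSubst ℬ) :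
    gradedEval ℬ f φ = FreeNonUnitalNonAssocAlgebra.lift F φ.1 f := rfl

lemma ker_gradedEval (ℬ : ZMod 2 → Submodule F B) :
    LinearMap.ker (gradedEval ℬ) = gradedIdentities ℬ := by
  ext f
  rw [LinearMap.mem_ker, funext_iff]
  exact ⟨fun h φ h0 h1 => h ⟨φ, h0, h1⟩, fun h φ => h φ.1 φ.2.1 φ.2.2⟩

lemma partialCodim_eq_finrank (ℬ : ZMod 2 → Submodule F B) (k l : ℕ) :
    partialCodim ℬ k l = Module.finrank F ((multilinearXY F k l).map (gradedEval ℬ)) := by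
  have h : (gradedIdentities ℬ).comap (multilinearXY F k l).subtype =
      LinearMap.ker ((gradedEval ℬ).comp (multilinearXY F k l).subtype) := by
    rw [LinearMap.ker_comp, ker_gradedEval]
  unfold partialCodim
  rw [h, (LinearMap.quotKerEquivRange _).finrank_eq, LinearMap.range_comp, Submodule.range_subtype]

/-- The finset of the letters `x_0, …, x_{k-1}, y_0, …, y_{l-1}`. -/
abbrev lettersXY (k l : ℕ) : Finset (ℕ ⊕ ℕ) := (Finset.range k).disjSum (Finset.range l)

lemma multilinearXY_eq_span (k l : ℕ) :
    multilinearXY F k l = Submodule.span F (MonoidAlgebra.ofMagma F (FreeMagma (ℕ ⊕ ℕ)) ''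
      {t | monomialLetters t = (lettersXY k l).val}) := rfl

lemma map_gradedEval_le_span (ℬ : ZMod 2 → Submodule F B) {k l : ℕ}
    {E : Set (GradedSubst ℬ → B)}
    (h : ∀ t, monomialLetters t = (lettersXY k l).val →
      gradedEval ℬ (MonoidAlgebra.ofMagma F _ t) ∈ Submodule.span F E) :
    (multilinearXY F k l).map (gradedEval ℬ) ≤ Submodule.span F E := by
  rw [multilinearXY_eq_span, Submodule.map_span, Submodule.span_le]
  rintro _ ⟨_, ⟨t, ht, rfl⟩, rfl⟩
  exact h t ht

lemma partialCodim_le_card (ℬ : ZMod 2 → Submodule F B) {k l : ℕ}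
    (E : Finset (GradedSubst ℬ → B))
    (h : ∀ t, monomialLetters t = (lettersXY k l).val →
      gradedEval ℬ (MonoidAlgebra.ofMagma F _ t) ∈ Submodule.span F (E : Set (GradedSubst ℬ → B))) :
    partialCodim ℬ k l ≤ E.card := by
  rw [partialCodim_eq_finrank]
  have : FiniteDimensional F (Submodule.span F (E : Set (GradedSubst ℬ → B))) :=
    FiniteDimensional.span_finset F E
  exact (Submodule.finrank_mono (map_gradedEval_le_span ℬ h)).trans (finrank_span_finset_le_card E)

lemma card_le_partialCodim (ℬ : ZMod 2 → Submodule F B) {k l : ℕ} {ι : Type*} [Fintype ι]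
    (E : Finset (GradedSubst ℬ → B))
    (hE : ∀ t, monomialLetters t = (lettersXY k l).val →
      gradedEval ℬ (MonoidAlgebra.ofMagma F _ t) ∈ Submodule.span F (E : Set (GradedSubst ℬ → B)))
    (f : ι → FreeXY F) (hf : ∀ s, f s ∈ multilinearXY F k l)
    (hind : LinearIndependent F fun s => gradedEval ℬ (f s)) :
    Fintype.card ι ≤ partialCodim ℬ k l := by
  rw [partialCodim_eq_finrank]
  have : FiniteDimensional F (Submodule.span F (E : Set (GradedSubst ℬ → B))) :=
    FiniteDimensional.span_finset F E
  have : FiniteDimensional F ((multilinearXY F k l).map (gradedEval ℬ)) :=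
    Submodule.finiteDimensional_of_le (map_gradedEval_le_span ℬ hE)
  let g : ι → (multilinearXY F k l).map (gradedEval ℬ) :=
    fun s => ⟨gradedEval ℬ (f s), Submodule.mem_map_of_mem (hf s)⟩
  have hg : LinearIndependent F g :=
    LinearIndependent.of_comp ((multilinearXY F k l).map (gradedEval ℬ)).subtype hind
  exact hg.fintype_card_le_finrank

end Codim

/-! ### Multiplication in the word algebra -/

namespace WordAlgebra

variable {F : Type*} [Field F] {K : ℕ → ℕ}

lemma linearMap_ext {M : Type*} [AddCommGroup M] [Module F M] {f g : WordAlgebra F K →ₗ[F] M}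
    (h : ∀ p, f (ofBasis F p) = g (ofBasis F p)) : f = g := by
  refine Finsupp.lhom_ext' fun p => LinearMap.ext_ring ?_
  exact h p

lemma ofBasis_mul_ofBasis (p q : WordBasis K) :
    ofBasis F p * ofBasis F q = mulTable F p q := by
  change mulLin F K (Finsupp.single p 1) (Finsupp.single q 1) = _
  have h : mulLin F K (Finsupp.single p 1) = (Finsupp.linearCombination F fun q => mulTable F p q :
      (WordBasis K →₀ F) →ₗ[F] WordAlgebra F K) :=
    (Finsupp.linearCombination_single F 1 p).trans (one_smul _ _)
  rw [h]
  exact (Finsupp.linearCombination_single F 1 q).trans (one_smul _ _)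

lemma ofBasis_ne_zero (p : WordBasis K) : ofBasis F p ≠ 0 :=
  fun h => one_ne_zero (Finsupp.single_eq_zero.mp h)

/-- The coefficient of a basis element. -/
noncomputable def coord (p : WordBasis K) : WordAlgebra F K →ₗ[F] F :=
  (Finsupp.lapply p : (WordBasis K →₀ F) →ₗ[F] F)

lemma coord_ofBasis_self (p : WordBasis K) : coord p (ofBasis F p) = 1 :=
  Finsupp.single_eq_same

lemma coord_ofBasis_of_ne {p q : WordBasis K} (h : q ≠ p) : coord p (ofBasis F q) = 0 :=
  Finsupp.single_eq_of_ne h.symm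

/-- The basis element whose right multiplication reads a letter: `a` for `false` and `b` for
`true`. -/
def letterBasis (K : ℕ → ℕ) (c : Bool) : WordBasis K := if c then .b else .a

/-- Right multiplication by the letters of a word, one after the other. -/
noncomputable def rightWord (F : Type*) [Field F] (K : ℕ → ℕ) :
    List Bool → (WordAlgebra F K →ₗ[F] WordAlgebra F K)
  | [] => LinearMap.id
  | c :: u => (rightWord F K u).comp (LinearMap.mulRight F (ofBasis F (letterBasis K c)))

lemma rightWord_cons (c : Bool) (u : List Bool) (x : WordAlgebra F K) :
    rightWord F K (c :: u) x = rightWord F K u (x * ofBasis F (letterBasis K c)) := rfl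

@[simp] lemma rightWord_nil (x : WordAlgebra F K) : rightWord F K [] x = x := rfl

lemma rightWord_concat (c : Bool) (u : List Bool) (x : WordAlgebra F K) :
    rightWord F K (u ++ [c]) x = rightWord F K u x * ofBasis F (letterBasis K c) := by
  induction u generalizing x with
  | nil => rfl
  | cons d u ih => rw [List.cons_append, rightWord_cons, ih, ← rightWord_cons]

/-- Right multiplication only sees the coefficients of `a` and `b`. -/
lemma mul_eq (x y : WordAlgebra F K) :
    x * y = coord .a y • (x * ofBasis F .a) + coord .b y • (x * ofBasis F .b) := by
  have key : LinearMap.mulLeft F x =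
      (coord .a).smulRight (x * ofBasis F .a) + (coord .b).smulRight (x * ofBasis F .b) := by
    refine linearMap_ext fun q => ?_
    cases q with
    | a => simp [coord_ofBasis_self, coord_ofBasis_of_ne]
    | b => simp [coord_ofBasis_self, coord_ofBasis_of_ne]
    | z i j =>
      have : LinearMap.mulRight F (ofBasis F (.z i j)) =
          (0 : WordAlgebra F K →ₗ[F] WordAlgebra F K) := by
        refine linearMap_ext fun p => ?_
        rw [LinearMap.mulRight_apply, ofBasis_mul_ofBasis]
        cases p <;> rfl
      have h := LinearMap.congr_fun this x
      simp only [LinearMap.mulRight_apply, LinearMap.zero_apply] at h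
      simp [coord_ofBasis_of_ne, h]
  exact LinearMap.congr_fun key y

/-- Products have no component along `a` and `b`. -/
lemma coord_mul_letter (c d : Bool) (x : WordAlgebra F K) :
    coord (letterBasis K c) (x * ofBasis F (letterBasis K d)) = 0 := by
  have : (coord (letterBasis K c)).comp (LinearMap.mulRight F (ofBasis F (letterBasis K d))) =
      (0 : WordAlgebra F K →ₗ[F] F) := by
    refine linearMap_ext fun p => ?_
    rw [LinearMap.comp_apply, LinearMap.mulRight_apply, ofBasis_mul_ofBasis]
    cases p <;> cases d <;> cases c <;>
      simp only [letterBasis, mulTable, Bool.false_eq_true, if_false, if_true, map_zero,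
        LinearMap.zero_apply] <;> split_ifs <;>
      first | exact map_zero _ | exact coord_ofBasis_of_ne (by simp)
  exact LinearMap.congr_fun this x

lemma coord_rightWord_cons (c d : Bool) (u : List Bool) (x : WordAlgebra F K) :
    coord (letterBasis K c) (rightWord F K (d :: u) x) = 0 := by
  induction u generalizing d x with
  | nil => exact coord_mul_letter c d x
  | cons e u ih => rw [rightWord_cons]; exact ih e _

lemma eq_blockWord_of_rightWord_ne_zero (u : List Bool) (i : ℕ) (j : Fin (K i))
    (h : rightWord F K u (ofBasis F (.z i j)) ≠ 0) : u = blockWord K u.length i j := by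
  induction u generalizing i j with
  | nil => rfl
  | cons c u ih =>
    rw [rightWord_cons, ofBasis_mul_ofBasis] at h
    rw [List.length_cons, blockWord_succ]
    cases c with
    | false =>
      simp only [letterBasis, mulTable, Bool.false_eq_true, if_false] at h
      split_ifs at h with hj
      · rw [if_neg hj.ne, ← ih _ _ h]
      · exact absurd (map_zero _) h
    | true =>
      simp only [letterBasis, mulTable, if_true] at h
      split_ifs at h with hj
      · rw [if_pos hj.1, ← ih _ _ h]
      · exact absurd (map_zero _) h

lemma mem_blockFactors_of_rightWord_ne_zero (hK : ∀ i, 0 < K i) {u : List Bool}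
    (h : rightWord F K u ≠ 0) : u ∈ blockFactors K u.length := by
  by_contra hu
  refine h (linearMap_ext fun p => ?_)
  cases u with
  | nil => exact absurd ⟨0, 0, hK 0, rfl⟩ hu
  | cons c u =>
    cases p with
    | z i j =>
      by_contra hne
      exact hu ⟨i, j, j.isLt, eq_blockWord_of_rightWord_ne_zero _ i j hne⟩
    | a => rw [rightWord_cons, ofBasis_mul_ofBasis]; exact map_zero _
    | b => rw [rightWord_cons, ofBasis_mul_ofBasis]; exact map_zero _

/-- Reading the word that starts at a basis element `z i j` leads to another basis element. -/
lemma exists_rightWord_blockWord (hK : ∀ i, 0 < K i) (n i : ℕ) (j : Fin (K i)) :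
    ∃ p, rightWord F K (blockWord K n i j) (ofBasis F (.z i j)) = ofBasis F p := by
  induction n generalizing i j with
  | zero => exact ⟨_, rfl⟩
  | succ n ih =>
    rw [blockWord_succ]
    split_ifs with hj
    · obtain ⟨p, hp⟩ := ih (i + 1) ⟨0, hK _⟩
      refine ⟨p, ?_⟩
      rw [rightWord_cons, ofBasis_mul_ofBasis, ← hp]
      simp [letterBasis, mulTable, hj, hK]
    · obtain ⟨p, hp⟩ := ih i ⟨j + 1, by omega⟩
      refine ⟨p, ?_⟩
      rw [rightWord_cons, ofBasis_mul_ofBasis, ← hp]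
      have : (j : ℕ) + 1 < K i := by omega
      simp [letterBasis, mulTable, this]

/-! ### The grading is determined by three of its values -/

section Grading

variable {𝒜 : ZMod 2 → Submodule F (WordAlgebra F K)}

lemma ofBasis_z_mem (hK : ∀ i, 0 < K i) (h𝒜 : IsZ2Grading 𝒜)
    (hz : ofBasis F (.z 0 ⟨0, hK 0⟩) ∈ 𝒜 0) (ha : ofBasis F .a ∈ 𝒜 0) (hb : ofBasis F .b ∈ 𝒜 1)
    (i : ℕ) (j : Fin (K i)) : ofBasis F (.z i j) ∈ 𝒜 (i : ZMod 2) := by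
  have step : ∀ i : ℕ, ofBasis F (.z i ⟨0, hK i⟩) ∈ 𝒜 (i : ZMod 2) →
      ∀ j (hj : j < K i), ofBasis F (.z i ⟨j, hj⟩) ∈ 𝒜 (i : ZMod 2) := by
    intro i hi j
    induction j with
    | zero => exact fun _ => hi
    | succ j ih =>
      intro hj
      have h := h𝒜.mul_mem _ _ _ (ih (by omega)) _ ha
      rw [ofBasis_mul_ofBasis, add_zero] at h
      simpa [mulTable, hj] using h
  have first : ∀ i : ℕ, ofBasis F (.z i ⟨0, hK i⟩) ∈ 𝒜 (i : ZMod 2) := by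
    intro i
    induction i with
    | zero => simpa using hz
    | succ i ih =>
      have hlast : K i - 1 < K i := Nat.sub_lt (hK i) one_pos
      have h := h𝒜.mul_mem _ _ _ (step i ih (K i - 1) hlast) _ hb
      rw [ofBasis_mul_ofBasis] at h
      simpa [mulTable, hK, Nat.sub_add_cancel (hK i)] using h
  exact step i (first i) j j.isLt

/-- A coefficient vanishes on one of the homogeneous components as soon as its basis element lies
in the other one and all basis elements are homogeneous. -/
lemma coord_eq_zero_of_mem (h𝒜 : IsZ2Grading 𝒜) (hhom : ∀ p, ∃ s, ofBasis F p ∈ 𝒜 s)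
    {p : WordBasis K} {s t : ZMod 2} (hst : s ≠ t) (hp : ofBasis F p ∈ 𝒜 s)
    {x : WordAlgebra F K} (hx : x ∈ 𝒜 t) : coord p x = 0 := by
  have hind := h𝒜.isInternal.submodule_iSupIndep
  have hdisj := hind.pairwiseDisjoint hst
  have hcases : ∀ r : ZMod 2, r = s ∨ r = t := by
    have h : ∀ a b : ZMod 2, a ≠ b → ∀ r, r = a ∨ r = b := by decide
    exact h s t hst
  -- `x` is split along the homogeneous basis; its part in the component of `p` vanishes.
  have key : ∀ y : WordAlgebra F K,
      ∃ y₁ ∈ 𝒜 s, ∃ y₂ ∈ 𝒜 t, y = y₁ + y₂ ∧ coord p y = coord p y₁ := by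
    intro y
    induction y using Finsupp.induction_linear with
    | zero => exact ⟨0, zero_mem _, 0, zero_mem _, (add_zero _).symm, rfl⟩
    | add y y' h h' =>
      obtain ⟨y₁, h₁, y₂, h₂, e, f⟩ := h
      obtain ⟨z₁, k₁, z₂, k₂, e', f'⟩ := h'
      refine ⟨y₁ + z₁, add_mem h₁ k₁, y₂ + z₂, add_mem h₂ k₂, ?_, ?_⟩
      · exact (congrArg₂ (· + ·) e e').trans (add_add_add_comm _ _ _ _)
      · exact (map_add (coord p) _ _).trans ((congrArg₂ (· + ·) f f').trans
          (map_add (coord p) _ _).symm)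
    | single q c =>
      have hq : (Finsupp.single q c : WordBasis K →₀ F) = c • (ofBasis F q : WordAlgebra F K) := by
        exact (Finsupp.smul_single_one q c).symm
      obtain ⟨r, hr⟩ := hhom q
      have hr' : c • (ofBasis F q : WordAlgebra F K) ∈ 𝒜 r := Submodule.smul_mem _ _ hr
      rcases hcases r with rfl | rfl
      · exact ⟨_, hr', 0, zero_mem _, hq.trans (add_zero _).symm, by rw [hq]⟩
      · refine ⟨0, zero_mem _, _, hr', hq.trans (zero_add _).symm, ?_⟩
        have hne : q ≠ p := by
          rintro rfl
          exact ofBasis_ne_zero _ (Submodule.disjoint_def.mp hdisj _ hp hr)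
        rw [hq, map_smul, coord_ofBasis_of_ne hne, map_zero, smul_zero]
  obtain ⟨x₁, h₁, x₂, h₂, e, f⟩ := key x
  have : x₁ ∈ 𝒜 t := by
    have h : x₁ = x - x₂ := by rw [e, add_sub_cancel_right]
    rw [h]; exact sub_mem hx h₂
  rw [f, Submodule.disjoint_def.mp hdisj _ h₁ this, map_zero]

/-- The data that the codimension estimates use: the components of the grading see only one of the
letters `a` and `b` each. -/
structure LetterGrading (𝒜 : ZMod 2 → Submodule F (WordAlgebra F K)) : Prop where
  coord_b : ∀ x ∈ 𝒜 0, coord .b x = 0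
  coord_a : ∀ x ∈ 𝒜 1, coord .a x = 0

lemma letterGrading (hK : ∀ i, 0 < K i) (h𝒜 : IsZ2Grading 𝒜)
    (hz : ofBasis F (.z 0 ⟨0, hK 0⟩) ∈ 𝒜 0) (ha : ofBasis F .a ∈ 𝒜 0)
    (hb : ofBasis F .b ∈ 𝒜 1) : LetterGrading 𝒜 := by
  have hhom : ∀ p : WordBasis K, ∃ s, ofBasis F p ∈ 𝒜 s
    | .a => ⟨0, ha⟩
    | .b => ⟨1, hb⟩
    | .z i j => ⟨_, ofBasis_z_mem hK h𝒜 hz ha hb i j⟩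
  exact ⟨fun x hx => coord_eq_zero_of_mem h𝒜 hhom one_ne_zero hb hx,
    fun x hx => coord_eq_zero_of_mem h𝒜 hhom zero_ne_one ha hx⟩

end Grading

end WordAlgebra

/-! ### Multilinear monomials on the unital hull -/

section Unitization

variable {F A : Type*} [Field F] [NonUnitalNonAssocRing A] [Module F A]
  {𝒜 : ZMod 2 → Submodule F A}

lemma snd_mem_of_mem_unitizationGrading {s : ZMod 2} {x : Unitization F A}
    (hx : x ∈ unitizationGrading 𝒜 s) : x.snd ∈ 𝒜 s := by
  obtain ⟨y, ⟨a, ha, rfl⟩, z, hz, rfl⟩ := Submodule.mem_sup.mp hx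
  have hz0 : z.snd = 0 := by
    split_ifs at hz
    · obtain ⟨c, rfl⟩ := Submodule.mem_span_singleton.mp hz
      simp
    · rw [(Submodule.mem_bot F).mp hz]; rfl
  simpa [hz0] using ha

lemma fst_eq_zero_of_mem_unitizationGrading {x : Unitization F A}
    (hx : x ∈ unitizationGrading 𝒜 1) : x.fst = 0 := by
  obtain ⟨y, ⟨a, ha, rfl⟩, z, hz, rfl⟩ := Submodule.mem_sup.mp hx
  rw [if_neg one_ne_zero] at hz
  rw [(Submodule.mem_bot F).mp hz]
  simp

lemma inr_mem_unitizationGrading {s : ZMod 2} {a : A} (ha : a ∈ 𝒜 s) :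
    (a : Unitization F A) ∈ unitizationGrading 𝒜 s :=
  Submodule.mem_sup_left ⟨a, ha, rfl⟩

lemma one_mem_unitizationGrading : (1 : Unitization F A) ∈ unitizationGrading 𝒜 0 :=
  Submodule.mem_sup_right (by rw [if_pos rfl]; exact Submodule.mem_span_singleton_self _)

end Unitization

namespace WordAlgebra

variable {F : Type*} [Field F] {K : ℕ → ℕ}

/-- The only coefficient of a value of the letter `c` that matters when it is a right factor: the
one of `a` for an even letter and of `b` for an odd one. -/
noncomputable def weight (c : ℕ ⊕ ℕ) : WordAlgebra F K →ₗ[F] F := coord (letterBasis K c.isRight)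

/-- The function `∏ λ_c • 1` of the unit coefficients `λ_c` of the values of the letters in
`L`. -/
noncomputable def unitTerm (L : Finset (ℕ ⊕ ℕ)) (φ : ℕ ⊕ ℕ → Unitization F (WordAlgebra F K)) :
    Unitization F (WordAlgebra F K) :=
  (∏ c ∈ L, (φ c).fst) • (1 : Unitization F (WordAlgebra F K))

/-- The contribution to the value of a monomial in the letters of `L` in which the letters outside
`S` take multiples of `1`, the letter `v` takes the leftmost place and the other letters of `S`
read the word `u`. -/
noncomputable def headTerm (L S : Finset (ℕ ⊕ ℕ)) (v : ℕ ⊕ ℕ) (u : List Bool)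
    (φ : ℕ ⊕ ℕ → Unitization F (WordAlgebra F K)) : Unitization F (WordAlgebra F K) :=
  ((∏ c ∈ L \ S, (φ c).fst) * ∏ c ∈ S.erase v, weight c (φ c).snd) •
    (rightWord F K u (φ v).snd : Unitization F (WordAlgebra F K))

/-- The triples `(S, v, u)` that index the terms `headTerm L S v u`. -/
def IsHeadIndex (L S : Finset (ℕ ⊕ ℕ)) (v : ℕ ⊕ ℕ) (u : List Bool) : Prop :=
  S ⊆ L ∧ v ∈ S ∧ u.length + 1 = S.card ∧ S.toRight.card ≤ u.count true + 1

/-- All the terms of the values of monomials in the letters of `L`. -/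
def termSet (𝒜 : ZMod 2 → Submodule F (WordAlgebra F K)) (L : Finset (ℕ ⊕ ℕ)) :
    Set (GradedSubst (unitizationGrading 𝒜) → Unitization F (WordAlgebra F K)) :=
  {g | (g = fun φ => unitTerm L φ.1) ∨
    ∃ S v u, IsHeadIndex L S v u ∧ g = fun φ => headTerm L S v u φ.1}

variable {𝒜 : ZMod 2 → Submodule F (WordAlgebra F K)}

lemma mul_letter_eq (hg : LetterGrading 𝒜) (φ : GradedSubst (unitizationGrading 𝒜)) (c : ℕ ⊕ ℕ)
    (x : WordAlgebra F K) : x * (φ.1 c).snd =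
      weight c (φ.1 c).snd • (x * ofBasis F (letterBasis K c.isRight)) := by
  rw [mul_eq]
  cases c with
  | inl i =>
    rw [hg.coord_b _ (snd_mem_of_mem_unitizationGrading (φ.2.1 i)), zero_smul, add_zero]; rfl
  | inr i =>
    rw [hg.coord_a _ (snd_mem_of_mem_unitizationGrading (φ.2.2 i)), zero_smul, zero_add]; rfl

lemma unitTerm_mul_unitTerm {L₁ L₂ : Finset (ℕ ⊕ ℕ)} (h : Disjoint L₁ L₂)
    (φ : ℕ ⊕ ℕ → Unitization F (WordAlgebra F K)) :
    unitTerm L₁ φ * unitTerm L₂ φ = unitTerm (L₁ ∪ L₂) φ := by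
  simp only [unitTerm, smul_mul_assoc, one_mul, smul_smul, Finset.prod_union h]

lemma unitTerm_mul_headTerm {L₁ L₂ S : Finset (ℕ ⊕ ℕ)} (h : Disjoint L₁ L₂) (hS : S ⊆ L₂)
    (v : ℕ ⊕ ℕ) (u : List Bool) (φ : ℕ ⊕ ℕ → Unitization F (WordAlgebra F K)) :
    unitTerm L₁ φ * headTerm L₂ S v u φ = headTerm (L₁ ∪ L₂) S v u φ := by
  have h1 : (L₁ ∪ L₂) \ S = L₁ ∪ L₂ \ S := by
    rw [Finset.union_sdiff_distrib, Finset.sdiff_eq_self_of_disjoint (h.mono_right hS)]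
  have h2 : Disjoint L₁ (L₂ \ S) := h.mono_right Finset.sdiff_subset
  simp only [unitTerm, headTerm, smul_mul_assoc, one_mul, smul_smul, h1, Finset.prod_union h2,
    mul_assoc]

lemma headTerm_mul_unitTerm {L₁ L₂ S : Finset (ℕ ⊕ ℕ)} (h : Disjoint L₁ L₂) (hS : S ⊆ L₁)
    (v : ℕ ⊕ ℕ) (u : List Bool) (φ : ℕ ⊕ ℕ → Unitization F (WordAlgebra F K)) :
    headTerm L₁ S v u φ * unitTerm L₂ φ = headTerm (L₁ ∪ L₂) S v u φ := by
  rw [Finset.union_comm, ← unitTerm_mul_headTerm h.symm hS]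
  simp only [unitTerm, mul_smul_comm, smul_mul_assoc, one_mul, mul_one]

/-- A product of two terms without unit part vanishes unless the right factor is a single letter,
which then extends the word read by the left factor. -/
lemma headTerm_mul_headTerm (hg : LetterGrading 𝒜) {L₁ L₂ S₁ S₂ : Finset (ℕ ⊕ ℕ)}
    (h : Disjoint L₁ L₂) {v₁ v₂ : ℕ ⊕ ℕ} {u₁ u₂ : List Bool} (h₁ : IsHeadIndex L₁ S₁ v₁ u₁)
    (h₂ : IsHeadIndex L₂ S₂ v₂ u₂) :
    (∀ φ : GradedSubst (unitizationGrading 𝒜),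
      headTerm L₁ S₁ v₁ u₁ φ.1 * headTerm L₂ S₂ v₂ u₂ φ.1 = 0) ∨
    ∃ S v u, IsHeadIndex (L₁ ∪ L₂) S v u ∧ ∀ φ : GradedSubst (unitizationGrading 𝒜),
      headTerm L₁ S₁ v₁ u₁ φ.1 * headTerm L₂ S₂ v₂ u₂ φ.1 = headTerm (L₁ ∪ L₂) S v u φ.1 := by
  obtain ⟨hS₁, hv₁, hl₁, ho₁⟩ := h₁
  obtain ⟨hS₂, hv₂, hl₂, ho₂⟩ := h₂
  cases u₂ with
  | cons d u₂ =>
    refine Or.inl fun φ => ?_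
    have hz : rightWord F K u₁ (φ.1 v₁).snd * rightWord F K (d :: u₂) (φ.1 v₂).snd = 0 := by
      rw [mul_eq]
      have ha := coord_rightWord_cons (F := F) (K := K) false d u₂ (φ.1 v₂).snd
      have hb := coord_rightWord_cons (F := F) (K := K) true d u₂ (φ.1 v₂).snd
      simp only [letterBasis, Bool.false_eq_true, if_false, if_true] at ha hb
      rw [ha, hb, zero_smul, zero_smul, add_zero]
    simp only [headTerm, smul_mul_assoc, mul_smul_comm, ← Unitization.inr_mul, hz,
      Unitization.inr_zero, smul_zero]
  | nil =>
    right
    obtain rfl : S₂ = {v₂} := by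
      obtain ⟨c, rfl⟩ := Finset.card_eq_one.mp hl₂.symm
      rw [Finset.mem_singleton.mp hv₂]
    have hv₂L : v₂ ∈ L₂ := hS₂ (Finset.mem_singleton_self _)
    have hnot : v₂ ∉ L₁ := Finset.disjoint_right.mp h hv₂L
    have hnot' : v₂ ∉ S₁ := fun hh => hnot (hS₁ hh)
    refine ⟨insert v₂ S₁, v₁, u₁ ++ [v₂.isRight], ⟨?_, Finset.mem_insert_of_mem hv₁, ?_, ?_⟩,
      fun φ => ?_⟩
    · exact Finset.insert_subset (Finset.mem_union_right _ hv₂L)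
        (hS₁.trans Finset.subset_union_left)
    · rw [Finset.card_insert_of_notMem hnot', ← hl₁]; simp
    · cases v₂ with
      | inl i => simpa using ho₁
      | inr i =>
        have := Finset.card_insert_le i S₁.toRight
        simp; omega
    · have hne : v₂ ≠ v₁ := fun hh => hnot' (hh ▸ hv₁)
      have e1 : (L₁ ∪ L₂) \ insert v₂ S₁ = L₁ \ S₁ ∪ L₂ \ {v₂} := by
        ext c
        simp only [Finset.mem_sdiff, Finset.mem_union, Finset.mem_insert, Finset.mem_singleton]
        have : c ∈ L₁ → c ≠ v₂ := fun hc hh => hnot (hh ▸ hc)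
        have : c ∈ L₂ → c ∉ S₁ := fun hc hh => Finset.disjoint_right.mp h hc (hS₁ hh)
        tauto
      have e2 : (insert v₂ S₁).erase v₁ = insert v₂ (S₁.erase v₁) :=
        Finset.erase_insert_of_ne hne
      have e3 : v₂ ∉ S₁.erase v₁ := fun hh => hnot' (Finset.mem_of_mem_erase hh)
      have e4 : Disjoint (L₁ \ S₁) (L₂ \ {v₂}) := h.mono Finset.sdiff_subset Finset.sdiff_subset
      simp only [headTerm, e1, e2, Finset.prod_insert e3, Finset.prod_union e4, smul_mul_assoc,
        mul_smul_comm, ← Unitization.inr_mul, rightWord_nil, mul_letter_eq hg, rightWord_concat,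
        Unitization.inr_smul, smul_smul, Finset.erase_singleton, Finset.prod_empty, mul_one]
      congr 1
      ring

lemma mul_mem_span_termSet (hg : LetterGrading 𝒜) {L₁ L₂ : Finset (ℕ ⊕ ℕ)}
    (h : Disjoint L₁ L₂)
    {f g : GradedSubst (unitizationGrading 𝒜) → Unitization F (WordAlgebra F K)}
    (hf : f ∈ Submodule.span F (termSet 𝒜 L₁)) (hg' : g ∈ Submodule.span F (termSet 𝒜 L₂)) :
    (fun φ => f φ * g φ) ∈ Submodule.span F (termSet 𝒜 (L₁ ∪ L₂)) := by
  induction hf using Submodule.span_induction with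
  | zero =>
    convert Submodule.zero_mem _
    exact zero_mul _
  | add f₁ f₂ _ _ h₁ h₂ =>
    exact (funext fun φ => add_mul (f₁ φ) (f₂ φ) (g φ) :
      (fun φ => (f₁ + f₂) φ * g φ) = (fun φ => f₁ φ * g φ) + fun φ => f₂ φ * g φ) ▸
      Submodule.add_mem _ h₁ h₂
  | smul r f _ h₁ =>
    exact (funext fun φ => smul_mul_assoc r (f φ) (g φ) :
      (fun φ => (r • f) φ * g φ) = r • fun φ => f φ * g φ) ▸ Submodule.smul_mem _ r h₁
  | mem f hf =>
    induction hg' using Submodule.span_induction with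
    | zero =>
      convert Submodule.zero_mem _
      exact mul_zero _
    | add g₁ g₂ _ _ h₁ h₂ =>
      exact (funext fun φ => mul_add (f φ) (g₁ φ) (g₂ φ) :
        (fun φ => f φ * (g₁ + g₂) φ) = (fun φ => f φ * g₁ φ) + fun φ => f φ * g₂ φ) ▸
        Submodule.add_mem _ h₁ h₂
    | smul r g _ h₁ =>
      exact (funext fun φ => mul_smul_comm r (f φ) (g φ) :
        (fun φ => f φ * (r • g) φ) = r • fun φ => f φ * g φ) ▸ Submodule.smul_mem _ r h₁
    | mem g hg' =>
      rcases hf with rfl | ⟨S₁, v₁, u₁, h₁, rfl⟩ <;> rcases hg' with rfl | ⟨S₂, v₂, u₂, h₂, rfl⟩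
      · exact Submodule.subset_span (Or.inl (funext fun φ => unitTerm_mul_unitTerm h φ.1))
      · refine Submodule.subset_span (Or.inr ⟨S₂, v₂, u₂, ?_,
          funext fun φ => unitTerm_mul_headTerm h h₂.1 v₂ u₂ φ.1⟩)
        exact ⟨h₂.1.trans Finset.subset_union_right, h₂.2⟩
      · refine Submodule.subset_span (Or.inr ⟨S₁, v₁, u₁, ?_,
          funext fun φ => headTerm_mul_unitTerm h h₁.1 v₁ u₁ φ.1⟩)
        exact ⟨h₁.1.trans Finset.subset_union_left, h₁.2⟩
      · rcases headTerm_mul_headTerm hg h h₁ h₂ with h0 | ⟨S, v, u, hi, h3⟩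
        · exact (funext h0 : (fun φ : GradedSubst (unitizationGrading 𝒜) =>
            headTerm L₁ S₁ v₁ u₁ φ.1 * headTerm L₂ S₂ v₂ u₂ φ.1) = 0) ▸ Submodule.zero_mem _
        · exact Submodule.subset_span (Or.inr ⟨S, v, u, hi, funext h3⟩)

/-- The value of a multilinear monomial is a combination of the terms above. -/
lemma gradedEval_mem_span_termSet (hg : LetterGrading 𝒜) (t : FreeMagma (ℕ ⊕ ℕ))
    (L : Finset (ℕ ⊕ ℕ)) (ht : monomialLetters t = L.val) :
    gradedEval (unitizationGrading 𝒜) (MonoidAlgebra.ofMagma F _ t) ∈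
      Submodule.span F (termSet 𝒜 L) := by
  induction t generalizing L with
  | ih1 c =>
    obtain rfl : L = {c} := by
      apply Finset.val_injective; exact ht.symm
    have h1 : (fun φ : GradedSubst (unitizationGrading 𝒜) => unitTerm {c} φ.1) ∈
        Submodule.span F (termSet 𝒜 {c}) := Submodule.subset_span (Or.inl rfl)
    have h2 : (fun φ : GradedSubst (unitizationGrading 𝒜) => headTerm {c} {c} c [] φ.1) ∈
        Submodule.span F (termSet 𝒜 {c}) := by
      refine Submodule.subset_span (Or.inr ⟨{c}, c, [], ⟨subset_rfl, by simp, by simp, ?_⟩, rfl⟩)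
      exact (Finset.card_toRight_le).trans (by simp)
    convert add_mem h1 h2 using 1
    funext φ
    rw [gradedEval_apply]
    refine (FreeNonUnitalNonAssocAlgebra.lift_of_apply F φ.1 c).trans ?_
    simp only [unitTerm, headTerm, Pi.add_apply]
    ext <;> simp
  | ih2 t₁ t₂ ih₁ ih₂ =>
    have hnd : (monomialLetters t₁ + monomialLetters t₂).Nodup := by
      have := L.nodup; rwa [← ht] at this
    obtain ⟨n₁, n₂, hd⟩ := Multiset.nodup_add.mp hnd
    have hd' : Disjoint (⟨monomialLetters t₁, n₁⟩ : Finset (ℕ ⊕ ℕ)) ⟨monomialLetters t₂, n₂⟩ :=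
      Finset.disjoint_val.mp hd
    have hL : L = ⟨monomialLetters t₁, n₁⟩ ∪ ⟨monomialLetters t₂, n₂⟩ := by
      rw [← Finset.disjUnion_eq_union _ _ hd']
      apply Finset.val_injective; exact ht.symm
    rw [hL]
    convert mul_mem_span_termSet hg hd' (ih₁ _ rfl) (ih₂ _ rfl) using 1
    funext φ
    simp only [gradedEval_apply]
    rw [← map_mul, ← map_mul]

end WordAlgebra

/-! ### Upper bounds for the partial codimensions -/

namespace WordAlgebra

variable {F : Type*} [Field F] {K : ℕ → ℕ}

/-- An upper bound for the number of nonzero terms `headTerm` in which `j` even and `l` odd letters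
do not take multiples of `1`: a leftmost letter and a factor of length `j + l - 1` are chosen, and
there is no suitable factor if `l` is too large. -/
noncomputable def headBound (K : ℕ → ℕ) (j l : ℕ) : ℕ :=
  if l ≤ maxBlockCount K (j + l - 1) + 1 then (j + l) * (blockFactors K (j + l - 1)).ncard else 0

variable {𝒜 : ZMod 2 → Submodule F (WordAlgebra F K)}

/-- The terms `headTerm L S v u` that do not vanish for lack of a factor `u`. -/
noncomputable def headTerms (𝒜 : ZMod 2 → Submodule F (WordAlgebra F K))
    (hfin : ∀ n, (blockFactors K n).Finite) (L S : Finset (ℕ ⊕ ℕ)) :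
    Finset (GradedSubst (unitizationGrading 𝒜) → Unitization F (WordAlgebra F K)) :=
  haveI := Classical.decEq (GradedSubst (unitizationGrading 𝒜) → Unitization F (WordAlgebra F K))
  if S.toRight.card ≤ maxBlockCount K (S.card - 1) + 1 then
    (S ×ˢ (hfin (S.card - 1)).toFinset).image fun p => fun φ => headTerm L S p.1 p.2 φ.1
  else ∅

lemma card_headTerms_le (hfin : ∀ n, (blockFactors K n).Finite) (L S : Finset (ℕ ⊕ ℕ)) :
    (headTerms 𝒜 hfin L S).card ≤ headBound K S.toLeft.card S.toRight.card := by
  unfold headTerms headBound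
  rw [Finset.card_toLeft_add_card_toRight]
  split_ifs
  · refine (@Finset.card_image_le _ _ _ _ (Classical.decEq _)).trans ?_
    rw [Finset.card_product, Set.ncard_eq_toFinset_card _ (hfin _)]
  · simp

lemma mem_headTerms_or_eq_zero (hK : ∀ i, 0 < K i) (hfin : ∀ n, (blockFactors K n).Finite)
    {L S : Finset (ℕ ⊕ ℕ)} {v : ℕ ⊕ ℕ} {u : List Bool} (h : IsHeadIndex L S v u) :
    (fun φ : GradedSubst (unitizationGrading 𝒜) => headTerm L S v u φ.1) ∈
      headTerms 𝒜 hfin L S ∨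
    (fun φ : GradedSubst (unitizationGrading 𝒜) => headTerm L S v u φ.1) = 0 := by
  obtain ⟨-, hv, hl, ho⟩ := h
  by_cases hu : rightWord F K u = 0
  · right
    funext φ
    simp [headTerm, hu]
  · left
    have hlen : S.card - 1 = u.length := by omega
    have hmem := mem_blockFactors_of_rightWord_ne_zero hK hu
    have hcount : u.count true ≤ maxBlockCount K u.length := by
      obtain ⟨i, j, -, h⟩ := hmem
      have h' : u.count true = blockCount K u.length i j := congrArg (List.count true) h
      rw [h']
      exact blockCount_le_max _ _ _
    rw [← hlen] at hmem hcount
    unfold headTerms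
    rw [if_pos (by omega)]
    exact (@Finset.mem_image _ _ (Classical.decEq _) _ _ _).mpr ⟨(v, u), by simp [hv, hmem], rfl⟩

/-- Odd letters never take multiples of `1`. -/
lemma headTerm_eq_zero {k l : ℕ} {S : Finset (ℕ ⊕ ℕ)} (hS : S.toRight ≠ Finset.range l)
    (hSL : S ⊆ lettersXY k l) (v : ℕ ⊕ ℕ) (u : List Bool)
    (φ : GradedSubst (unitizationGrading 𝒜)) : headTerm (lettersXY k l) S v u φ.1 = 0 := by
  have hsub : S.toRight ⊆ Finset.range l := (Finset.subset_disjSum.mp hSL).2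
  obtain ⟨i, hi, hi'⟩ : ∃ i ∈ Finset.range l, i ∉ S.toRight := by
    by_contra! hh
    exact hS (hsub.antisymm hh)
  have : ∏ c ∈ lettersXY k l \ S, (φ.1 c).fst = 0 := by
    refine Finset.prod_eq_zero (i := Sum.inr i) ?_
      (fst_eq_zero_of_mem_unitizationGrading (φ.2.2 i))
    rw [Finset.mem_sdiff, Finset.inr_mem_disjSum]
    exact ⟨hi, fun h => hi' (Finset.mem_toRight.mpr h)⟩
  rw [headTerm, this, zero_mul, zero_smul]

/-- The polynomial functions on the unital hull are spanned by the terms in which the even letters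
outside some set `S` take multiples of `1`. -/
lemma exists_spanning_unitization (hK : ∀ i, 0 < K i) (hfin : ∀ n, (blockFactors K n).Finite)
    (hg : LetterGrading 𝒜) (k l : ℕ) :
    ∃ E : Finset (GradedSubst (unitizationGrading 𝒜) → Unitization F (WordAlgebra F K)),
      (∀ t, monomialLetters t = (lettersXY k l).val →
        gradedEval (unitizationGrading 𝒜) (MonoidAlgebra.ofMagma F _ t) ∈
          Submodule.span F (E : Set (GradedSubst (unitizationGrading 𝒜) → _))) ∧
      E.card ≤
        (if l = 0 then 1 else 0) + ∑ j ∈ Finset.range (k + 1), k.choose j * headBound K j l := by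
  classical
  let U : Finset (GradedSubst (unitizationGrading 𝒜) → Unitization F (WordAlgebra F K)) :=
    if l = 0 then {fun φ => unitTerm (lettersXY k l) φ.1} else ∅
  let E := U ∪ (Finset.range k).powerset.biUnion fun S =>
    headTerms 𝒜 hfin (lettersXY k l) (S.disjSum (Finset.range l))
  have hcard : E.card ≤ (if l = 0 then 1 else 0) +
      ∑ j ∈ Finset.range (k + 1), k.choose j * headBound K j l := by
    refine (Finset.card_union_le _ _).trans (add_le_add ?_ ?_)
    · simp only [U]; split_ifs <;> simp
    · refine Finset.card_biUnion_le.trans ?_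
      have h := Finset.sum_powerset_apply_card (fun j => headBound K j l) (x := Finset.range k)
      simp only [Finset.card_range, smul_eq_mul] at h
      rw [← h]
      refine Finset.sum_le_sum fun S _ => (card_headTerms_le hfin _ _).trans ?_
      simp
  refine ⟨E, fun t ht => ?_, hcard⟩
  refine Submodule.span_le.mpr ?_ (gradedEval_mem_span_termSet hg t _ ht)
  rintro g (rfl | ⟨S, v, u, hi, rfl⟩)
  · by_cases hl : l = 0
    · exact Submodule.subset_span (Finset.mem_coe.mpr
        (Finset.mem_union_left _ (by simp [U, hl])))
    · have h0 : (fun φ : GradedSubst (unitizationGrading 𝒜) => unitTerm (lettersXY k l) φ.1) = 0 := by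
        funext φ
        have : ∏ c ∈ lettersXY k l, (φ.1 c).fst = 0 :=
          Finset.prod_eq_zero (i := Sum.inr 0) (by simp; omega)
            (fst_eq_zero_of_mem_unitizationGrading (φ.2.2 0))
        rw [unitTerm, this, zero_smul]; rfl
      rw [h0]; exact Submodule.zero_mem _
  · by_cases hS : S.toRight = Finset.range l
    · rcases mem_headTerms_or_eq_zero (𝒜 := 𝒜) hK hfin hi with h | h
      · refine Submodule.subset_span (Finset.mem_coe.mpr (Finset.mem_union_right _
          (Finset.mem_biUnion.mpr ⟨S.toLeft, ?_, ?_⟩)))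
        · exact Finset.mem_powerset.mpr (Finset.subset_disjSum.mp hi.1).1
        · rwa [← hS, Finset.toLeft_disjSum_toRight]
      · rw [h]; exact Submodule.zero_mem _
    · have h0 : (fun φ : GradedSubst (unitizationGrading 𝒜) =>
          headTerm (lettersXY k l) S v u φ.1) = 0 :=
        funext fun φ => headTerm_eq_zero hS hi.1 v u φ
      rw [h0]; exact Submodule.zero_mem _

/-- A substitution in the algebra, as a substitution in its unital hull. -/
noncomputable def GradedSubst.toUnitization (φ : GradedSubst 𝒜) :
    GradedSubst (unitizationGrading 𝒜) :=
  ⟨fun c => (φ.1 c : Unitization F (WordAlgebra F K)),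
    fun i => inr_mem_unitizationGrading (φ.2.1 i), fun i => inr_mem_unitizationGrading (φ.2.2 i)⟩

/-- The restriction of polynomial functions from the unital hull to the algebra. -/
noncomputable def restrictFun (𝒜 : ZMod 2 → Submodule F (WordAlgebra F K)) :
    (GradedSubst (unitizationGrading 𝒜) → Unitization F (WordAlgebra F K)) →ₗ[F]
      (GradedSubst 𝒜 → WordAlgebra F K) where
  toFun g φ := (g (GradedSubst.toUnitization φ)).snd
  map_add' _ _ := rfl
  map_smul' _ _ := rfl

lemma restrictFun_apply (g : GradedSubst (unitizationGrading 𝒜) → Unitization F (WordAlgebra F K))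
    (φ : GradedSubst 𝒜) : restrictFun 𝒜 g φ = (g (GradedSubst.toUnitization φ)).snd := rfl

lemma lift_toUnitization (φ : GradedSubst 𝒜) (t : FreeMagma (ℕ ⊕ ℕ)) :
    FreeNonUnitalNonAssocAlgebra.lift F (GradedSubst.toUnitization φ).1
      (MonoidAlgebra.ofMagma F _ t) =
    (FreeNonUnitalNonAssocAlgebra.lift F φ.1 (MonoidAlgebra.ofMagma F _ t) :
      Unitization F (WordAlgebra F K)) := by
  induction t with
  | ih1 c =>
    refine (FreeNonUnitalNonAssocAlgebra.lift_of_apply F _ c).trans ?_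
    exact congrArg Unitization.inr (FreeNonUnitalNonAssocAlgebra.lift_of_apply F φ.1 c).symm
  | ih2 t₁ t₂ ih₁ ih₂ => rw [map_mul, map_mul, map_mul, ih₁, ih₂, Unitization.inr_mul]

lemma restrictFun_gradedEval (t : FreeMagma (ℕ ⊕ ℕ)) :
    restrictFun 𝒜 (gradedEval (unitizationGrading 𝒜) (MonoidAlgebra.ofMagma F _ t)) =
      gradedEval 𝒜 (MonoidAlgebra.ofMagma F _ t) := by
  funext φ
  exact congrArg (fun x => x.snd) (lift_toUnitization φ t)

lemma exists_spanning (hK : ∀ i, 0 < K i) (hfin : ∀ n, (blockFactors K n).Finite)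
    (hg : LetterGrading 𝒜) (k l : ℕ) :
    ∃ E : Finset (GradedSubst 𝒜 → WordAlgebra F K),
      (∀ t, monomialLetters t = (lettersXY k l).val →
        gradedEval 𝒜 (MonoidAlgebra.ofMagma F _ t) ∈
          Submodule.span F (E : Set (GradedSubst 𝒜 → WordAlgebra F K))) ∧
      E.card ≤ headBound K k l := by
  classical
  let E := (headTerms 𝒜 hfin (lettersXY k l) (lettersXY k l)).image (restrictFun 𝒜)
  have hcard : E.card ≤ headBound K k l := by
    refine Finset.card_image_le.trans ((card_headTerms_le hfin _ _).trans ?_)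
    simp
  refine ⟨E, fun t ht => ?_, hcard⟩
  rw [← restrictFun_gradedEval]
  have h := Submodule.mem_map_of_mem (f := restrictFun 𝒜) (gradedEval_mem_span_termSet hg t _ ht)
  rw [Submodule.map_span] at h
  refine Submodule.span_le.mpr ?_ h
  rintro _ ⟨g, rfl | ⟨S, v, u, hi, rfl⟩, rfl⟩
  · have h0 : restrictFun 𝒜 (fun φ => unitTerm (lettersXY k l) φ.1) = 0 := by
      funext φ
      simp [restrictFun_apply, unitTerm]
    rw [h0]; exact Submodule.zero_mem _
  · by_cases hS : S = lettersXY k l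
    · subst hS
      rcases mem_headTerms_or_eq_zero (𝒜 := 𝒜) hK hfin hi with h | h
      · exact Submodule.subset_span (Finset.mem_coe.mpr (Finset.mem_image_of_mem _ h))
      · rw [h, map_zero]; exact Submodule.zero_mem _
    · have h0 : restrictFun 𝒜 (fun φ => headTerm (lettersXY k l) S v u φ.1) = 0 := by
        funext φ
        obtain ⟨c, hc, hc'⟩ := Finset.exists_of_ssubset (hi.1.ssubset_of_ne hS)
        have : ∏ c ∈ lettersXY k l \ S, ((GradedSubst.toUnitization φ).1 c).fst = 0 :=
          Finset.prod_eq_zero (i := c) (Finset.mem_sdiff.mpr ⟨hc, hc'⟩) rfl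
        simp [restrictFun_apply, headTerm, this]
      rw [h0]; exact Submodule.zero_mem _

lemma partialCodim_unitization_le (hK : ∀ i, 0 < K i) (hfin : ∀ n, (blockFactors K n).Finite)
    (hg : LetterGrading 𝒜) (k l : ℕ) :
    partialCodim (unitizationGrading 𝒜) k l ≤
      (if l = 0 then 1 else 0) + ∑ j ∈ Finset.range (k + 1), k.choose j * headBound K j l := by
  obtain ⟨E, hE, hcard⟩ := exists_spanning_unitization hK hfin hg k l
  exact (partialCodim_le_card _ E hE).trans hcard

lemma partialCodim_le (hK : ∀ i, 0 < K i) (hfin : ∀ n, (blockFactors K n).Finite)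
    (hg : LetterGrading 𝒜) (k l : ℕ) : partialCodim 𝒜 k l ≤ headBound K k l := by
  obtain ⟨E, hE, hcard⟩ := exists_spanning hK hfin hg k l
  exact (partialCodim_le_card _ E hE).trans hcard

end WordAlgebra

/-! ### Commutators of generators -/

section Commutator

variable {F : Type*} [Field F]

/-- The span of the monomials with a given multiset of letters. -/
noncomputable def monomialSpan (F : Type*) [Field F] (M : Multiset (ℕ ⊕ ℕ)) : Submodule F (FreeXY F) :=
  Submodule.span F (MonoidAlgebra.ofMagma F (FreeMagma (ℕ ⊕ ℕ)) '' {t | monomialLetters t = M})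

/-- The generator of the free algebra given by a letter. -/
noncomputable abbrev gen (F : Type*) [Field F] (c : ℕ ⊕ ℕ) : FreeXY F :=
  FreeNonUnitalNonAssocAlgebra.of F c

lemma gen_mem_monomialSpan (c : ℕ ⊕ ℕ) : gen F c ∈ monomialSpan F {c} :=
  Submodule.subset_span ⟨FreeMagma.of c, rfl, rfl⟩

lemma mul_gen_mem_monomialSpan {M : Multiset (ℕ ⊕ ℕ)} {f : FreeXY F} (hf : f ∈ monomialSpan F M)
    (c : ℕ ⊕ ℕ) : f * gen F c ∈ monomialSpan F (c ::ₘ M) := by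
  have h : monomialSpan F M ≤ (monomialSpan F (c ::ₘ M)).comap (LinearMap.mulRight F (gen F c)) := by
    refine Submodule.span_le.mpr ?_
    rintro _ ⟨t, ht, rfl⟩
    refine Submodule.subset_span ⟨t * FreeMagma.of c, ?_, map_mul _ _ _⟩
    change monomialLetters t + {c} = c ::ₘ M
    rw [show monomialLetters t = M from ht, add_comm, Multiset.singleton_add]
  exact h hf

lemma gen_mul_mem_monomialSpan {M : Multiset (ℕ ⊕ ℕ)} {f : FreeXY F} (hf : f ∈ monomialSpan F M)
    (c : ℕ ⊕ ℕ) : gen F c * f ∈ monomialSpan F (c ::ₘ M) := by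
  have h : monomialSpan F M ≤ (monomialSpan F (c ::ₘ M)).comap (LinearMap.mulLeft F (gen F c)) := by
    refine Submodule.span_le.mpr ?_
    rintro _ ⟨t, ht, rfl⟩
    refine Submodule.subset_span ⟨FreeMagma.of c * t, ?_, map_mul _ _ _⟩
    change {c} + monomialLetters t = c ::ₘ M
    rw [show monomialLetters t = M from ht, Multiset.singleton_add]
  exact h hf

/-- The left-normed commutator `[…[[x, φ c₁], φ c₂], …, φ c_r]`. -/
def leftCommutator {B : Type*} [NonUnitalNonAssocRing B] (φ : ℕ ⊕ ℕ → B) (x : B)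
    (cs : List (ℕ ⊕ ℕ)) : B :=
  cs.foldl (fun y c => y * φ c - φ c * y) x

/-- The left-normed product `(…((x φ c₁) φ c₂)…) φ c_r`. -/
def leftProduct {B : Type*} [NonUnitalNonAssocRing B] (φ : ℕ ⊕ ℕ → B) (x : B)
    (cs : List (ℕ ⊕ ℕ)) : B :=
  cs.foldl (fun y c => y * φ c) x

lemma leftCommutator_mem {M : Multiset (ℕ ⊕ ℕ)} {f : FreeXY F} (hf : f ∈ monomialSpan F M)
    (cs : List (ℕ ⊕ ℕ)) : leftCommutator (gen F) f cs ∈ monomialSpan F (M + cs) := by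
  induction cs generalizing f M with
  | nil => simpa [leftCommutator] using hf
  | cons c cs ih =>
    have h := ih (sub_mem (mul_gen_mem_monomialSpan hf c) (gen_mul_mem_monomialSpan hf c))
    rwa [Multiset.cons_add, ← Multiset.add_cons] at h

lemma leftProduct_mem {M : Multiset (ℕ ⊕ ℕ)} {f : FreeXY F} (hf : f ∈ monomialSpan F M)
    (cs : List (ℕ ⊕ ℕ)) : leftProduct (gen F) f cs ∈ monomialSpan F (M + cs) := by
  induction cs generalizing f M with
  | nil => simpa [leftProduct] using hf
  | cons c cs ih =>
    have h := ih (mul_gen_mem_monomialSpan hf c)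
    rwa [Multiset.cons_add, ← Multiset.add_cons] at h

section Eval

variable {B : Type*} [NonUnitalNonAssocRing B] [Module F B]
  [IsScalarTower F B B] [SMulCommClass F B B]

lemma lift_leftCommutator (φ : ℕ ⊕ ℕ → B) (f : FreeXY F) (cs : List (ℕ ⊕ ℕ)) :
    FreeNonUnitalNonAssocAlgebra.lift F φ (leftCommutator (gen F) f cs) =
      leftCommutator φ (FreeNonUnitalNonAssocAlgebra.lift F φ f) cs := by
  induction cs generalizing f with
  | nil => rfl
  | cons c cs ih =>
    refine (ih _).trans ?_
    rw [map_sub, map_mul, map_mul, FreeNonUnitalNonAssocAlgebra.lift_of_apply]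
    rfl

lemma lift_leftProduct (φ : ℕ ⊕ ℕ → B) (f : FreeXY F) (cs : List (ℕ ⊕ ℕ)) :
    FreeNonUnitalNonAssocAlgebra.lift F φ (leftProduct (gen F) f cs) =
      leftProduct φ (FreeNonUnitalNonAssocAlgebra.lift F φ f) cs := by
  induction cs generalizing f with
  | nil => rfl
  | cons c cs ih =>
    refine (ih _).trans ?_
    rw [map_mul, FreeNonUnitalNonAssocAlgebra.lift_of_apply]
    rfl

end Eval

lemma leftCommutator_zero {B : Type*} [NonUnitalNonAssocRing B] (φ : ℕ ⊕ ℕ → B)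
    (cs : List (ℕ ⊕ ℕ)) : leftCommutator φ 0 cs = 0 := by
  induction cs with
  | nil => rfl
  | cons c cs ih =>
    change leftCommutator φ (0 * φ c - φ c * 0) cs = 0
    rw [zero_mul, mul_zero, sub_zero, ih]

lemma leftProduct_zero {B : Type*} [NonUnitalNonAssocRing B] (φ : ℕ ⊕ ℕ → B)
    (cs : List (ℕ ⊕ ℕ)) : leftProduct φ 0 cs = 0 := by
  induction cs with
  | nil => rfl
  | cons c cs ih =>
    change leftProduct φ (0 * φ c) cs = 0
    rw [zero_mul, ih]

section Unital

variable {B : Type*} [NonAssocRing B]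

lemma leftCommutator_eq_zero_of_mem {φ : ℕ ⊕ ℕ → B} {c : ℕ ⊕ ℕ} (hc : φ c = 1) (x : B)
    {cs : List (ℕ ⊕ ℕ)} (h : c ∈ cs) : leftCommutator φ x cs = 0 := by
  induction cs generalizing x with
  | nil => simp at h
  | cons d cs ih =>
    change leftCommutator φ (x * φ d - φ d * x) cs = 0
    rcases List.mem_cons.mp h with rfl | h
    · rw [hc, mul_one, one_mul, sub_self, leftCommutator_zero]
    · exact ih _ h

lemma leftCommutator_one {φ : ℕ ⊕ ℕ → B} {cs : List (ℕ ⊕ ℕ)} (h : cs ≠ []) :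
    leftCommutator φ 1 cs = 0 := by
  cases cs with
  | nil => exact absurd rfl h
  | cons d cs =>
    change leftCommutator φ (1 * φ d - φ d * 1) cs = 0
    rw [mul_one, one_mul, sub_self, leftCommutator_zero]

lemma leftProduct_eq_self {φ : ℕ ⊕ ℕ → B} (x : B) {cs : List (ℕ ⊕ ℕ)} (h : ∀ c ∈ cs, φ c = 1) :
    leftProduct φ x cs = x := by
  induction cs generalizing x with
  | nil => rfl
  | cons c cs ih =>
    change leftProduct φ (x * φ c) cs = x
    rw [h c List.mem_cons_self, mul_one, ih _ fun d hd => h d (List.mem_cons_of_mem _ hd)]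

end Unital

end Commutator

/-- Letters can be arranged so that their parities follow a given word. -/
lemma exists_letters_of_word (u : List Bool) (xs ys : Multiset ℕ)
    (hx : xs.card = u.count false) (hy : ys.card = u.count true) :
    ∃ cs : List (ℕ ⊕ ℕ), cs.map Sum.isRight = u ∧
      (cs : Multiset (ℕ ⊕ ℕ)) = xs.map Sum.inl + ys.map Sum.inr := by
  induction u generalizing xs ys with
  | nil =>
    rw [List.count_nil, Multiset.card_eq_zero] at hx hy
    exact ⟨[], rfl, by simp [hx, hy]⟩
  | cons c u ih =>
    cases c with
    | false =>
      rw [List.count_cons_self] at hx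
      rw [List.count_cons_of_ne (by decide)] at hy
      obtain ⟨i, hi⟩ := Multiset.card_pos_iff_exists_mem.mp (by omega : 0 < xs.card)
      obtain ⟨xs, rfl⟩ := Multiset.exists_cons_of_mem hi
      obtain ⟨cs, h1, h2⟩ := ih xs ys (by simpa using hx) hy
      refine ⟨Sum.inl i :: cs, by simp [h1], ?_⟩
      rw [← Multiset.cons_coe, h2, Multiset.map_cons, Multiset.cons_add]
    | true =>
      rw [List.count_cons_self] at hy
      rw [List.count_cons_of_ne (by decide)] at hx
      obtain ⟨i, hi⟩ := Multiset.card_pos_iff_exists_mem.mp (by omega : 0 < ys.card)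
      obtain ⟨ys, rfl⟩ := Multiset.exists_cons_of_mem hi
      obtain ⟨cs, h1, h2⟩ := ih xs ys hx (by simpa using hy)
      refine ⟨Sum.inr i :: cs, by simp [h1], ?_⟩
      rw [← Multiset.cons_coe, h2, Multiset.map_cons, Multiset.add_cons]

/-! ### Lower bounds for the partial codimensions -/

namespace WordAlgebra

variable {F : Type*} [Field F] {K : ℕ → ℕ}

lemma letter_mul (c : Bool) (x : WordAlgebra F K) : ofBasis F (letterBasis K c) * x = 0 := by
  have : LinearMap.mulLeft F (ofBasis F (letterBasis K c)) =
      (0 : WordAlgebra F K →ₗ[F] WordAlgebra F K) := by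
    refine linearMap_ext fun p => ?_
    rw [LinearMap.mulLeft_apply, ofBasis_mul_ofBasis]
    cases c <;> rfl
  exact LinearMap.congr_fun this x

/-- Since `a` and `b` annihilate the algebra from the left, a left-normed commutator with them is
the left-normed product. -/
lemma leftCommutator_eq_rightWord {φ : ℕ ⊕ ℕ → WordAlgebra F K} {cs : List (ℕ ⊕ ℕ)}
    (h : ∀ c ∈ cs, φ c = ofBasis F (letterBasis K c.isRight)) (x : WordAlgebra F K) :
    leftCommutator φ x cs = rightWord F K (cs.map Sum.isRight) x := by
  induction cs generalizing x with
  | nil => rfl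
  | cons c cs ih =>
    change leftCommutator φ (x * φ c - φ c * x) cs = _
    rw [ih fun d hd => h d (List.mem_cons_of_mem _ hd), h c List.mem_cons_self, letter_mul,
      sub_zero]
    rfl

lemma leftCommutator_inr {φ : ℕ ⊕ ℕ → Unitization F (WordAlgebra F K)}
    {ψ : ℕ ⊕ ℕ → WordAlgebra F K} {cs : List (ℕ ⊕ ℕ)}
    (h : ∀ c ∈ cs, φ c = (ψ c : Unitization F (WordAlgebra F K))) (x : WordAlgebra F K) :
    leftCommutator φ (x : Unitization F (WordAlgebra F K)) cs =
      ((leftCommutator ψ x cs : WordAlgebra F K) : Unitization F (WordAlgebra F K)) := by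
  induction cs generalizing x with
  | nil => rfl
  | cons c cs ih =>
    change leftCommutator φ (x * φ c - φ c * x) cs = _
    rw [h c List.mem_cons_self, ← Unitization.inr_mul, ← Unitization.inr_mul,
      ← Unitization.inr_sub, ih fun d hd => h d (List.mem_cons_of_mem _ hd)]
    rfl

variable {𝒜 : ZMod 2 → Submodule F (WordAlgebra F K)}

/-- The substitution that puts a given element for one letter, `a` for the other even letters and
`b` for the odd ones. -/
noncomputable def letterSubst (v : ℕ) (x : WordAlgebra F K) : ℕ ⊕ ℕ → WordAlgebra F K :=
  fun c => if c = Sum.inl v then x else ofBasis F (letterBasis K c.isRight)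

lemma letterSubst_of_ne {v : ℕ} {c : ℕ ⊕ ℕ} (h : c ≠ Sum.inl v) (x : WordAlgebra F K) :
    letterSubst v x c = ofBasis F (letterBasis K c.isRight) := if_neg h

lemma letterSubst_mem (ha : ofBasis F .a ∈ 𝒜 0) (hb : ofBasis F .b ∈ 𝒜 1) (v : ℕ)
    {x : WordAlgebra F K} (hx : x ∈ 𝒜 0) :
    (∀ i, letterSubst v x (Sum.inl i) ∈ 𝒜 0) ∧ ∀ i, letterSubst v x (Sum.inr i) ∈ 𝒜 1 := by
  refine ⟨fun i => ?_, fun i => ?_⟩ <;> unfold letterSubst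
  · split_ifs
    · exact hx
    · exact ha
  · rw [if_neg (by simp)]
    exact hb

/-- The letters of `S` and the odd ones split off a leftmost even letter and arranged along a
word. -/
lemma exists_head_and_letters {S : Finset ℕ} {l : ℕ} {u : List Bool}
    (hS : S.card = u.count false + 1) (hl : l = u.count true) :
    ∃ v ∈ S, ∃ cs : List (ℕ ⊕ ℕ), cs.map Sum.isRight = u ∧
      Sum.inl v ::ₘ (cs : Multiset (ℕ ⊕ ℕ)) = (S.disjSum (Finset.range l)).val := by
  obtain ⟨v, hv⟩ := Finset.card_pos.mp (by omega : 0 < S.card)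
  obtain ⟨cs, h1, h2⟩ := exists_letters_of_word u (S.erase v).val (Finset.range l).val
    (by rw [Finset.card_val, Finset.card_erase_of_mem hv]; omega)
    (by rw [Finset.card_val, Finset.card_range, hl])
  refine ⟨v, hv, cs, h1, ?_⟩
  rw [h2, ← Multiset.cons_add, ← Multiset.map_cons, Finset.erase_val, Multiset.cons_erase hv]
  rfl

lemma ne_head_of_mem {S : Finset (ℕ ⊕ ℕ)} {v : ℕ ⊕ ℕ} {cs : List (ℕ ⊕ ℕ)}
    (h : v ::ₘ (cs : Multiset (ℕ ⊕ ℕ)) = S.val) : ∀ c ∈ cs, c ≠ v := by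
  rintro c hc rfl
  have hnd : (c ::ₘ (cs : Multiset (ℕ ⊕ ℕ))).Nodup := h ▸ S.nodup
  exact (Multiset.nodup_cons.mp hnd).1 hc

/-- The codimension is positive if the letters can be arranged along a word that starts at an even
block. -/
lemma one_le_partialCodim (hK : ∀ i, 0 < K i) (hfin : ∀ n, (blockFactors K n).Finite)
    (hg : LetterGrading 𝒜) (ha : ofBasis F .a ∈ 𝒜 0) (hb : ofBasis F .b ∈ 𝒜 1) {i n k l : ℕ}
    (hz : ofBasis F (.z i ⟨0, hK i⟩) ∈ 𝒜 0) (hn : k + l = n + 1) (hl : l = blockCount K n i 0) :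
    1 ≤ partialCodim 𝒜 k l := by
  have hcount := List.count_false_add_count_true (blockWord K n i 0)
  rw [length_blockWord] at hcount
  obtain ⟨v, -, cs, hcs, hletters⟩ := exists_head_and_letters (S := Finset.range k)
    (u := blockWord K n i 0) (by rw [Finset.card_range]; unfold blockCount at hl; omega) hl
  let φ : GradedSubst 𝒜 := ⟨_, letterSubst_mem ha hb v hz⟩
  obtain ⟨E, hE, -⟩ := exists_spanning hK hfin hg k l
  refine card_le_partialCodim (ι := Unit) 𝒜 E hE
    (fun _ => leftCommutator (gen F) (gen F (Sum.inl v)) cs) (fun _ => ?_) ?_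
  · have h := leftCommutator_mem (gen_mem_monomialSpan (F := F) (Sum.inl v)) cs
    rwa [Multiset.singleton_add, hletters] at h
  · rw [linearIndependent_unique_iff]
    intro h0
    have h := congrFun h0 φ
    rw [gradedEval_apply, lift_leftCommutator, FreeNonUnitalNonAssocAlgebra.lift_of_apply,
      leftCommutator_eq_rightWord
        (fun c hc => letterSubst_of_ne (ne_head_of_mem hletters c hc) _), hcs] at h
    obtain ⟨p, hp⟩ := exists_rightWord_blockWord (F := F) hK n i ⟨0, hK i⟩
    have hv : φ.1 (Sum.inl v) = ofBasis F (.z i ⟨0, hK i⟩) := if_pos rfl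
    rw [hv] at h
    exact ofBasis_ne_zero p (hp.symm.trans h)

/-- For each set `S` of even letters of the right size there is a polynomial in the letters of `S`
and the odd letters, multiplied by the remaining even letters, that vanishes when `1` is put for a
letter of `S`, but not under all substitutions of `1` for the letters outside `S`. -/
lemma exists_proper_polynomial (hK : ∀ i, 0 < K i) (ha : ofBasis F .a ∈ 𝒜 0)
    (hb : ofBasis F .b ∈ 𝒜 1) {i n k l : ℕ} (hz : ofBasis F (.z i ⟨0, hK i⟩) ∈ 𝒜 0)
    (hn0 : n ≠ 0) (hl : l = blockCount K n i 0) {S : Finset ℕ} (hSk : S ⊆ Finset.range k)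
    (hS : S.card + l = n + 1) :
    ∃ f ∈ multilinearXY F k l, ∃ φ : GradedSubst (unitizationGrading 𝒜),
      (∀ j ∉ S, φ.1 (Sum.inl j) = 1) ∧ gradedEval (unitizationGrading 𝒜) f φ ≠ 0 ∧
      ∀ ψ : GradedSubst (unitizationGrading 𝒜), (∃ j ∈ S, ψ.1 (Sum.inl j) = 1) →
        gradedEval (unitizationGrading 𝒜) f ψ = 0 := by
  have hcount := List.count_false_add_count_true (blockWord K n i 0)
  rw [length_blockWord] at hcount
  obtain ⟨v, hv, cs, hcs, hletters⟩ := exists_head_and_letters (S := S)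
    (u := blockWord K n i 0) (by unfold blockCount at hl; omega) hl
  have hcs0 : cs ≠ [] := by
    rintro rfl
    have := congrArg List.length hcs
    simp at this
    exact hn0 this.symm
  let rest : List (ℕ ⊕ ℕ) := (Finset.range k \ S).toList.map Sum.inl
  have hrest : ∀ c ∈ rest, ∃ j ∉ S, c = Sum.inl j := by
    intro c hc
    obtain ⟨j, hj, rfl⟩ := List.mem_map.mp hc
    exact ⟨j, (Finset.mem_sdiff.mp (Finset.mem_toList.mp hj)).2, rfl⟩
  have heval : ∀ ψ : GradedSubst (unitizationGrading 𝒜),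
      gradedEval (unitizationGrading 𝒜)
        (leftProduct (gen F) (leftCommutator (gen F) (gen F (Sum.inl v)) cs) rest) ψ =
      leftProduct ψ.1 (leftCommutator ψ.1 (ψ.1 (Sum.inl v)) cs) rest := fun ψ => by
    rw [gradedEval_apply, lift_leftProduct, lift_leftCommutator,
      FreeNonUnitalNonAssocAlgebra.lift_of_apply]
  have hmem : ∀ c, c ∈ cs ∨ c = Sum.inl v ↔ c ∈ S.disjSum (Finset.range l) := fun c => by
    rw [← Finset.mem_val, ← hletters, Multiset.mem_cons, Multiset.mem_coe, or_comm]
  let φ' : ℕ ⊕ ℕ → Unitization F (WordAlgebra F K) := fun c =>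
    if c ∈ S.disjSum (Finset.range l) ∨ c.isRight then
      (letterSubst v (ofBasis F (.z i ⟨0, hK i⟩)) c : Unitization F (WordAlgebra F K))
    else 1
  have hsub := letterSubst_mem ha hb v hz
  let φ : GradedSubst (unitizationGrading 𝒜) := ⟨φ', by
    refine ⟨fun j => ?_, fun j => ?_⟩ <;> simp only [φ']
    · split_ifs
      · exact inr_mem_unitizationGrading (hsub.1 j)
      · exact one_mem_unitizationGrading
    · rw [if_pos (by simp)]
      exact inr_mem_unitizationGrading (hsub.2 j)⟩
  have hφ1 : ∀ j ∉ S, φ.1 (Sum.inl j) = 1 := fun j hj => by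
    simp [φ, φ', hj]
  refine ⟨leftProduct (gen F) (leftCommutator (gen F) (gen F (Sum.inl v)) cs) rest, ?_, φ, hφ1,
    ?_, ?_⟩
  · have h := leftProduct_mem
      (leftCommutator_mem (gen_mem_monomialSpan (F := F) (Sum.inl v)) cs) rest
    rw [Multiset.singleton_add, hletters] at h
    have hM : (S.disjSum (Finset.range l)).val + (rest : Multiset (ℕ ⊕ ℕ)) =
        (lettersXY k l).val := by
      change S.val.map Sum.inl + (Finset.range l).val.map Sum.inr +
        (((Finset.range k \ S).toList.map Sum.inl : List (ℕ ⊕ ℕ)) : Multiset (ℕ ⊕ ℕ)) =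
        (Finset.range k).val.map Sum.inl + (Finset.range l).val.map Sum.inr
      rw [← Multiset.map_coe, Finset.coe_toList, add_right_comm, ← Multiset.map_add,
        Finset.sdiff_val, add_tsub_cancel_of_le (Finset.val_le_iff.mpr hSk)]
    rwa [hM] at h
  · rw [heval, leftProduct_eq_self _ fun c hc => by
      obtain ⟨j, hj, rfl⟩ := hrest c hc
      exact hφ1 j hj]
    have hφ2 : ∀ c, c ∈ S.disjSum (Finset.range l) → φ.1 c =
        (letterSubst v (ofBasis F (.z i ⟨0, hK i⟩)) c : Unitization F (WordAlgebra F K)) :=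
      fun c hc => if_pos (Or.inl hc)
    rw [hφ2 _ ((hmem _).mp (Or.inr rfl)), leftCommutator_inr
      (fun c hc => hφ2 c ((hmem c).mp (Or.inl hc))),
      leftCommutator_eq_rightWord
        (fun c hc => letterSubst_of_ne (ne_head_of_mem hletters c hc) _), hcs]
    obtain ⟨p, hp⟩ := exists_rightWord_blockWord (F := F) hK n i ⟨0, hK i⟩
    have hv : letterSubst v (ofBasis F (.z i ⟨0, hK i⟩)) (Sum.inl v) =
      ofBasis F (.z i ⟨0, hK i⟩) := if_pos rfl
    rw [hv, hp]
    intro h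
    exact ofBasis_ne_zero p (Unitization.inr_injective (h.trans (Unitization.inr_zero _).symm))
  · rintro ψ ⟨j, hj, hψ⟩
    rw [heval]
    have h0 : leftCommutator ψ.1 (ψ.1 (Sum.inl v)) cs = 0 := by
      rcases (hmem (Sum.inl j)).mpr (by simpa using hj) with h | h
      · exact leftCommutator_eq_zero_of_mem hψ _ h
      · rw [← h, hψ, leftCommutator_one hcs0]
    rw [h0, leftProduct_zero]

/-- A lower bound for the codimensions of the unital hull: the polynomials that belong to the
different sets `S` are independent modulo the identities. -/
lemma choose_le_partialCodim_unitization (hK : ∀ i, 0 < K i)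
    (hfin : ∀ n, (blockFactors K n).Finite) (hg : LetterGrading 𝒜) (ha : ofBasis F .a ∈ 𝒜 0)
    (hb : ofBasis F .b ∈ 𝒜 1) {i n j k l : ℕ} (hz : ofBasis F (.z i ⟨0, hK i⟩) ∈ 𝒜 0)
    (hn0 : n ≠ 0) (hl : l = blockCount K n i 0) (hn : j + l = n + 1) :
    k.choose j ≤ partialCodim (unitizationGrading 𝒜) k l := by
  let ι := {S // S ∈ (Finset.range k).powersetCard j}
  have hS : ∀ S : ι, S.1 ⊆ Finset.range k ∧ S.1.card = j :=
    fun S => Finset.mem_powersetCard.mp S.2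
  choose f hf φ hφ1 hφ hψ using fun S : ι =>
    exists_proper_polynomial hK ha hb hz hn0 hl (hS S).1 (by rw [(hS S).2, hn])
  obtain ⟨E, hE, -⟩ := exists_spanning_unitization hK hfin hg k l
  have h := card_le_partialCodim (ι := ι) _ E hE f hf ?_
  · rwa [Fintype.card_coe, Finset.card_powersetCard, Finset.card_range] at h
  · rw [Fintype.linearIndependent_iff]
    intro r hr S₀
    have h0 := congrFun hr (φ S₀)
    rw [Finset.sum_apply, Finset.sum_eq_single S₀] at h0
    · simpa [hφ S₀] using h0
    · intro S _ hne
      obtain ⟨a, haS, haS₀⟩ : ∃ a ∈ S.1, a ∉ S₀.1 := by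
        by_contra! hsub
        exact hne (Subtype.ext (Finset.eq_of_subset_of_card_le hsub
          (by rw [(hS S).2, (hS S₀).2])))
      rw [Pi.smul_apply, hψ S (φ S₀) ⟨a, haS, hφ1 S₀ a haS₀⟩, smul_zero]
    · exact fun h => absurd (Finset.mem_univ _) h

end WordAlgebra

/-! ### Exponential growth of sequences and binomial coefficients -/

/-- A sequence has exponential growth rate `L` if it is caught between the geometric sequences of
ratios close to `L`. -/
lemma tendsto_rpow_one_div {u : ℕ → ℝ} {L r₀ : ℝ} (hr₀ : 0 < r₀) (hL : r₀ < L)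
    (hu : ∀ n, 0 ≤ u n)
    (hupper : ∀ r, L < r → ∃ C, 0 < C ∧ ∀ᶠ n in atTop, u n ≤ C * r ^ n)
    (hlower : ∀ r, r₀ < r → r < L → ∃ C, 0 < C ∧ ∀ᶠ n in atTop, r ^ n ≤ C * u n) :
    Tendsto (fun n : ℕ => u n ^ (1 / (n : ℝ))) atTop (𝓝 L) := by
  have hroot : ∀ C : ℝ, 0 < C → ∀ r : ℝ, 0 < r →
      Tendsto (fun n : ℕ => (C * r ^ n) ^ (1 / (n : ℝ))) atTop (𝓝 r) := by
    intro C hC r hr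
    have h1 : Tendsto (fun n : ℕ => C ^ (1 / (n : ℝ)) * r) atTop (𝓝 (C ^ (0 : ℝ) * r)) :=
      ((Real.continuousAt_const_rpow hC.ne').tendsto.comp
        tendsto_one_div_atTop_nhds_zero_nat).mul_const r
    rw [Real.rpow_zero, one_mul] at h1
    refine h1.congr' ?_
    filter_upwards [eventually_ne_atTop 0] with n hn
    rw [Real.mul_rpow hC.le (pow_nonneg hr.le _), one_div, Real.pow_rpow_inv_natCast hr.le hn]
  refine tendsto_order.mpr ⟨fun a ha => ?_, fun a ha => ?_⟩
  · obtain ⟨r, hr, hrL⟩ := exists_between (max_lt ha hL)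
    obtain ⟨C, hC, h⟩ := hlower r ((le_max_right _ _).trans_lt hr) hrL
    have hr0 : 0 < r := hr₀.trans ((le_max_right _ _).trans_lt hr)
    filter_upwards [h, (tendsto_order.mp (hroot C⁻¹ (inv_pos.mpr hC) r hr0)).1 a
      ((le_max_left _ _).trans_lt hr)] with n hn hn'
    refine hn'.trans_le (Real.rpow_le_rpow (by positivity) ?_ (by positivity))
    rw [inv_mul_le_iff₀ hC]
    exact hn
  · obtain ⟨r, hr, hra⟩ := exists_between ha
    obtain ⟨C, hC, h⟩ := hupper r hr
    have hr0 : 0 < r := hr₀.trans (hL.trans hr)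
    filter_upwards [h, (tendsto_order.mp (hroot C hC r hr0)).2 a hra] with n hn hn'
    exact (Real.rpow_le_rpow (hu n) hn (by positivity)).trans_lt hn'

lemma exists_const_forall_le {y z : ℕ → ℝ} (hy : ∀ n, 0 ≤ y n) (hz : ∀ n, 0 < z n) {C : ℝ}
    (h : ∀ᶠ n in atTop, y n ≤ C * z n) : ∃ C', 0 < C' ∧ ∀ n, y n ≤ C' * z n := by
  obtain ⟨N, hN⟩ := eventually_atTop.mp h
  have hsum : ∀ n, 0 ≤ y n / z n := fun n => div_nonneg (hy n) (hz n).le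
  have hS : 0 ≤ ∑ i ∈ Finset.range N, y i / z i := Finset.sum_nonneg fun i _ => hsum i
  refine ⟨|C| + 1 + ∑ i ∈ Finset.range N, y i / z i, by positivity, fun n => ?_⟩
  rw [← div_le_iff₀ (hz n)]
  rcases lt_or_ge n N with hn | hn
  · have := Finset.single_le_sum (f := fun i => y i / z i) (fun i _ => hsum i)
      (Finset.mem_range.mpr hn)
    have := abs_nonneg C
    linarith
  · have := (div_le_iff₀ (hz n)).mpr (hN n hn)
    have := le_abs_self C
    linarith

lemma exists_const_pow_mul_le (d : ℕ) {r s : ℝ} (hr : 0 < r) (hrs : r < s) :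
    ∃ C, 0 < C ∧ ∀ n : ℕ, (n : ℝ) ^ d * r ^ n ≤ C * s ^ n := by
  have hs : 0 < s := hr.trans hrs
  have h := tendsto_pow_const_mul_const_pow_of_abs_lt_one d
    (r := r / s) (by rw [abs_of_pos (by positivity)]; exact (div_lt_one hs).mpr hrs)
  refine exists_const_forall_le (C := 1) (fun n => by positivity) (fun n => by positivity) ?_
  filter_upwards [h.eventually (ge_mem_nhds one_pos)] with n hn
  rwa [div_pow, mul_div_assoc', div_le_one (by positivity), ← one_mul (s ^ n)] at hn

lemma factorial_mul_pow_le (a b : ℕ) : a.factorial * a ^ b ≤ b.factorial * a ^ a := by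
  rcases le_total a b with h | h
  · calc a.factorial * a ^ b = a.factorial * a ^ (b - a) * a ^ a := by
          rw [mul_assoc, ← pow_add, Nat.sub_add_cancel h]
      _ ≤ b.factorial * a ^ a :=
          Nat.mul_le_mul_right _ (Nat.factorial_mul_pow_sub_le_factorial h)
  · have h1 := Nat.factorial_mul_descFactorial (Nat.sub_le a b)
    rw [Nat.sub_sub_self h] at h1
    calc a.factorial * a ^ b ≤ b.factorial * a ^ (a - b) * a ^ b := by
          rw [← h1]
          exact Nat.mul_le_mul_right _ (Nat.mul_le_mul_left _ (Nat.descFactorial_le_pow _ _))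
      _ = b.factorial * a ^ a := by rw [mul_assoc, ← pow_add, Nat.sub_add_cancel h]

/-- The largest term of the expansion of `(l + (n - l)) ^ n` is the one with index `l`. -/
lemma pow_self_le_choose {n l : ℕ} (hl : l ≤ n) :
    n ^ n ≤ (n + 1) * (n.choose l * (l ^ l * (n - l) ^ (n - l))) := by
  have hterm : ∀ i ∈ Finset.range (n + 1), l ^ i * (n - l) ^ (n - i) * n.choose i ≤
      n.choose l * (l ^ l * (n - l) ^ (n - l)) := by
    intro i hi
    have hi : i ≤ n := Nat.lt_succ_iff.mp (Finset.mem_range.mp hi)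
    have h1 := factorial_mul_pow_le l i
    have h2 := factorial_mul_pow_le (n - l) (n - i)
    have h3 := Nat.choose_mul_factorial_mul_factorial hi
    have h4 := Nat.choose_mul_factorial_mul_factorial hl
    refine Nat.le_of_mul_le_mul_left ?_
      (Nat.mul_pos l.factorial_pos (n - l).factorial_pos)
    calc l.factorial * (n - l).factorial * (l ^ i * (n - l) ^ (n - i) * n.choose i)
        = n.choose i * ((l.factorial * l ^ i) * ((n - l).factorial * (n - l) ^ (n - i))) := by
          ring
      _ ≤ n.choose i * ((i.factorial * l ^ l) * ((n - i).factorial * (n - l) ^ (n - l))) := by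
          gcongr
      _ = (n.choose i * i.factorial * (n - i).factorial) * (l ^ l * (n - l) ^ (n - l)) := by ring
      _ = l.factorial * (n - l).factorial * (n.choose l * (l ^ l * (n - l) ^ (n - l))) := by
          rw [h3, ← h4]; ring
  have h := Finset.sum_le_card_nsmul _ _ _ hterm
  have h5 := add_pow l (n - l) n
  simp only [Nat.cast_id, Nat.add_sub_cancel' hl] at h5
  rwa [Finset.card_range, smul_eq_mul, ← h5] at h

open Real in
lemma exp_mul_binEntropy_le {n l : ℕ} (hn : n ≠ 0) (hl : l ≤ n) :
    exp (n * binEntropy (l / n)) ≤ (n + 1) * n.choose l := by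
  have hn0 : (n : ℝ) ≠ 0 := Nat.cast_ne_zero.mpr hn
  obtain ⟨d, rfl⟩ := Nat.exists_eq_add_of_le hl
  have hterm : ∀ x : ℝ, ((l + d : ℕ) : ℝ) * (x / (l + d : ℕ) * log (x / (l + d : ℕ))⁻¹) =
      x * log (l + d : ℕ) - x * log x := by
    intro x
    rcases eq_or_ne x 0 with rfl | hx
    · simp
    · rw [log_inv, log_div hx hn0]
      field_simp
      ring
  have hsub : (1 : ℝ) - l / (l + d : ℕ) = d / (l + d : ℕ) := by
    rw [eq_div_iff hn0, sub_mul, div_mul_cancel₀ _ hn0]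
    push_cast; ring
  have hent : ((l + d : ℕ) : ℝ) * binEntropy (l / (l + d : ℕ)) =
      (l + d : ℕ) * log (l + d : ℕ) - (l * log l + d * log d) := by
    rw [binEntropy, hsub, mul_add, hterm, hterm]
    push_cast
    ring
  have hmain := pow_self_le_choose hl
  rw [Nat.add_sub_cancel_left] at hmain
  have hmain' : ((l + d : ℕ) : ℝ) ^ (l + d) ≤
      (((l + d : ℕ) : ℝ) + 1) * ((l + d).choose l * ((l : ℝ) ^ l * (d : ℝ) ^ d)) := by
    exact_mod_cast hmain
  have hexp : ∀ k : ℕ, exp (k * log k) = (k : ℝ) ^ k := by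
    intro k
    rcases Nat.eq_zero_or_pos k with rfl | hk
    · simp
    · rw [mul_comm, ← rpow_def_of_pos (Nat.cast_pos.mpr hk), rpow_natCast]
  have hpos : (0 : ℝ) < (l : ℝ) ^ l * (d : ℝ) ^ d := by
    rw [← hexp, ← hexp]; positivity
  rw [hent, exp_sub, exp_add, hexp, hexp, hexp, div_le_iff₀ hpos]
  linarith

open Real in
/-- The Chernoff bound for the binomial coefficients below `L`; the factor `(1 - β) / β ≥ 1` makes
it uniform in `l ≤ L`. -/
lemma choose_le_exp {β : ℝ} (h0 : 0 < β) (h1 : β ≤ 1 / 2) {s l L : ℕ} (hl : l ≤ L) :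
    (s.choose l : ℝ) ≤ exp (-(s * log (1 - β)) + L * (log (1 - β) - log β)) := by
  have h2 : 0 < 1 - β := by linarith
  rcases lt_or_ge s l with hs | hs
  · rw [Nat.choose_eq_zero_of_lt hs, Nat.cast_zero]; positivity
  have hterm : β ^ l * (1 - β) ^ (s - l) * s.choose l ≤ 1 := by
    have h := Finset.single_le_sum
      (f := fun i => β ^ i * (1 - β) ^ (s - i) * (s.choose i : ℝ))
      (fun i _ => by positivity) (Finset.mem_range.mpr (Nat.lt_succ_of_le hs))
    rw [← add_pow] at h
    simpa using h
  have hlog : 0 ≤ log (1 - β) - log β := by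
    have := log_le_log h0 (by linarith : β ≤ 1 - β)
    linarith
  have hpow : β ^ l * (1 - β) ^ (s - l) = exp (l * log β + (s - l : ℕ) * log (1 - β)) := by
    rw [exp_add, mul_comm (l : ℝ), mul_comm ((s - l : ℕ) : ℝ), ← rpow_def_of_pos h0,
      ← rpow_def_of_pos h2, rpow_natCast, rpow_natCast]
  rw [hpow, ← le_div_iff₀' (exp_pos _), one_div, ← exp_neg] at hterm
  refine hterm.trans (exp_le_exp.mpr ?_)
  rw [Nat.cast_sub hs]
  have hlL : (l : ℝ) ≤ L := Nat.cast_le.mpr hl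
  nlinarith [mul_le_mul_of_nonneg_right hlL hlog]

/-! ### Growth of the codimension bounds -/

section Growth

variable {K : ℕ → ℕ}

/-- The largest density of letters `true` in long factors exists, because `maxBlockCount` is
subadditive. -/
lemma exists_density (hK : ∀ i, 2 ≤ K i) {c : ℕ} (hc : ∀ i, K i ≤ c) :
    ∃ β : ℝ, 0 < β ∧ β ≤ 1 / 2 ∧
      Tendsto (fun n : ℕ => (maxBlockCount K n : ℝ) / n) atTop (𝓝 β) := by
  have hsub : Subadditive fun n => (maxBlockCount K n : ℝ) := fun m n => by
    have h : (maxBlockCount K (m + n) : ℝ) ≤ maxBlockCount K m + maxBlockCount K n := by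
      exact_mod_cast maxBlockCount_add_le K m n
    exact h
  have hlim := hsub.tendsto_lim ⟨0, by rintro _ ⟨n, rfl⟩; positivity⟩
  have hinv := tendsto_one_div_atTop_nhds_zero_nat (𝕜 := ℝ)
  have hc0 : (0 : ℝ) < c := by
    have := hc 0; have := hK 0
    exact Nat.cast_pos.mpr (by omega)
  refine ⟨_, lt_of_lt_of_le (one_div_pos.mpr hc0) ?_, ?_, hlim⟩
  · have h1 : Tendsto (fun n : ℕ => 1 / (c : ℝ) - 1 / (n : ℝ)) atTop (𝓝 (1 / (c : ℝ) - 0)) :=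
      tendsto_const_nhds.sub hinv
    rw [sub_zero] at h1
    refine le_of_tendsto_of_tendsto h1 hlim ?_
    filter_upwards [eventually_gt_atTop 0] with n hn
    have h := le_mul_blockCount hc (fun i => one_le_two.trans (hK i)) n 0 0
      (by have := hK 0; omega)
    have h' : n ≤ c * maxBlockCount K n + c :=
      (by omega : n ≤ _).trans (Nat.add_le_add_right
        (Nat.mul_le_mul_left c (blockCount_le_max (K := K) n 0 0)) c)
    have h'' : (n : ℝ) ≤ c * maxBlockCount K n + c := by exact_mod_cast h'
    have hn' : (0 : ℝ) < n := Nat.cast_pos.mpr hn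
    rw [div_sub_div _ _ hc0.ne' hn'.ne', div_le_div_iff₀ (by positivity) hn']
    nlinarith
  · have h1 : Tendsto (fun n : ℕ => 1 / 2 + 1 / (n : ℝ)) atTop (𝓝 (1 / 2 + 0)) :=
      tendsto_const_nhds.add hinv
    rw [add_zero] at h1
    refine le_of_tendsto_of_tendsto hlim h1 ?_
    filter_upwards [eventually_gt_atTop 0] with n hn
    obtain ⟨i, j, hij⟩ := exists_blockCount_eq_max K n
    have h := (two_mul_blockCount_le hK n i).1 j
    rw [hij] at h
    have h' : 2 * (maxBlockCount K n : ℝ) ≤ n + 1 := by exact_mod_cast h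
    have hn' : (0 : ℝ) < n := Nat.cast_pos.mpr hn
    rw [div_le_iff₀ hn', add_mul, one_div_mul_cancel hn'.ne']
    linarith

open Real in
lemma exists_choose_mul_headBound_le {C₀ : ℕ}
    (hC₀ : ∀ n, (blockFactors K n).ncard ≤ C₀ * (n + 1)) {β : ℝ} (h0 : 0 < β) (h1 : β ≤ 1 / 2)
    (hβ : Tendsto (fun n : ℕ => (maxBlockCount K n : ℝ) / n) atTop (𝓝 β)) {r : ℝ}
    (hr : exp (binEntropy β) < r) :
    ∃ C, 0 < C ∧ ∀ j l, ((j + l).choose l * WordAlgebra.headBound K j l : ℝ) ≤ C * r ^ (j + l) := by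
  obtain ⟨r', hr', hrr'⟩ := exists_between hr
  have hr'0 : 0 < r' := (exp_pos _).trans hr'
  have hlogr' : binEntropy β < log r' := (lt_log_iff_exp_lt hr'0).mpr hr'
  set x : ℕ → ℝ := fun s =>
    -(s * log (1 - β)) + (maxBlockCount K s + 1 : ℕ) * (log (1 - β) - log β) with hx
  have hinv := tendsto_one_div_atTop_nhds_zero_nat (𝕜 := ℝ)
  have hlim : Tendsto (fun s : ℕ => x s / s) atTop (𝓝 (binEntropy β)) := by
    have h : Tendsto (fun s : ℕ => -log (1 - β) +
        ((maxBlockCount K s : ℝ) / s + 1 / s) * (log (1 - β) - log β)) atTop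
        (𝓝 (-log (1 - β) + (β + 0) * (log (1 - β) - log β))) :=
      tendsto_const_nhds.add ((hβ.add hinv).mul_const _)
    have hval : -log (1 - β) + (β + 0) * (log (1 - β) - log β) = binEntropy β := by
      rw [binEntropy, log_inv, log_inv]; ring
    rw [hval] at h
    refine h.congr' ?_
    filter_upwards [eventually_gt_atTop 0] with s hs
    have hs' : (s : ℝ) ≠ 0 := Nat.cast_ne_zero.mpr hs.ne'
    simp only [hx]
    push_cast
    field_simp
  obtain ⟨C₁, hC₁, hC₁'⟩ : ∃ C, 0 < C ∧ ∀ s : ℕ, exp (x s) ≤ C * r' ^ s := by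
    refine exists_const_forall_le (C := 1) (fun s => (exp_pos _).le)
      (fun s => pow_pos hr'0 s) ?_
    filter_upwards [hlim.eventually (gt_mem_nhds hlogr'), eventually_gt_atTop 0] with s hs hs0
    have hs' : (0 : ℝ) < s := Nat.cast_pos.mpr hs0
    rw [div_lt_iff₀ hs'] at hs
    rw [one_mul, ← rpow_natCast, rpow_def_of_pos hr'0]
    exact exp_le_exp.mpr hs.le
  obtain ⟨C₂, hC₂, hC₂'⟩ := exists_const_pow_mul_le 2 hr'0 hrr'
  refine ⟨(C₀ + 1) * C₁ * C₂, by positivity, fun j l => ?_⟩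
  set s := j + l with hs
  have hr0 : 0 < r := hr'0.trans hrr'
  unfold WordAlgebra.headBound
  rw [← hs]
  split_ifs with hl
  · have hl' : l ≤ maxBlockCount K s + 1 :=
      hl.trans (Nat.succ_le_succ (maxBlockCount_mono K (Nat.sub_le s 1)))
    have hchoose := (choose_le_exp (s := s) h0 h1 hl').trans (hC₁' s)
    have hcount : s * (blockFactors K (s - 1)).ncard ≤ C₀ * s ^ 2 := by
      rcases Nat.eq_zero_or_pos s with h | h
      · simp [h]
      · have := hC₀ (s - 1)
        rw [Nat.sub_add_cancel h] at this
        calc s * (blockFactors K (s - 1)).ncard ≤ s * (C₀ * s) := Nat.mul_le_mul_left _ this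
          _ = C₀ * s ^ 2 := by ring
    have hcount' : ((s * (blockFactors K (s - 1)).ncard : ℕ) : ℝ) ≤ (C₀ + 1) * (s : ℝ) ^ 2 := by
      refine (Nat.cast_le.mpr hcount).trans ?_
      push_cast
      nlinarith [sq_nonneg (s : ℝ)]
    calc (s.choose l : ℝ) * ((s * (blockFactors K (s - 1)).ncard : ℕ) : ℝ)
        ≤ (C₁ * r' ^ s) * ((C₀ + 1) * (s : ℝ) ^ 2) :=
          mul_le_mul hchoose hcount' (Nat.cast_nonneg _) (by positivity)
      _ = (C₀ + 1) * C₁ * ((s : ℝ) ^ 2 * r' ^ s) := by ring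
      _ ≤ (C₀ + 1) * C₁ * (C₂ * r ^ s) :=
          mul_le_mul_of_nonneg_left (hC₂' s) (by positivity)
      _ = (C₀ + 1) * C₁ * C₂ * r ^ s := by ring
  · rw [Nat.cast_zero, mul_zero]; positivity

open Real in
lemma exists_pow_le_choose {l : ℕ → ℕ} (hl : ∀ s, l s ≤ s) {β : ℝ}
    (hβ : Tendsto (fun s : ℕ => (l s : ℝ) / s) atTop (𝓝 β)) {r : ℝ} (hr0 : 0 < r)
    (hr : r < exp (binEntropy β)) :
    ∃ C, 0 < C ∧ ∀ s : ℕ, r ^ s ≤ C * s.choose (l s) := by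
  obtain ⟨r', hr', hrr'⟩ := exists_between hr
  have hr'0 : 0 < r' := hr0.trans hr'
  have hlim : Tendsto (fun s : ℕ => exp (binEntropy ((l s : ℝ) / s))) atTop
      (𝓝 (exp (binEntropy β))) :=
    (continuous_exp.comp binEntropy_continuous).continuousAt.tendsto.comp hβ
  obtain ⟨C, hC, hC'⟩ := exists_const_pow_mul_le 1 hr0 hr'
  have hpos : ∀ s : ℕ, (0 : ℝ) < s.choose (l s) := fun s =>
    Nat.cast_pos.mpr (Nat.choose_pos (hl s))
  refine exists_const_forall_le (C := 2 * C) (fun s => (pow_pos hr0 s).le) hpos ?_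
  filter_upwards [hlim.eventually (lt_mem_nhds hrr'), eventually_gt_atTop 0] with s hs hs0
  have hs1 : (1 : ℝ) ≤ s := Nat.one_le_cast.mpr hs0
  have hpow : r' ^ s ≤ ((s : ℝ) + 1) * s.choose (l s) := by
    refine le_trans ?_ (exp_mul_binEntropy_le hs0.ne' (hl s))
    rw [exp_nat_mul]
    exact pow_le_pow_left₀ hr'0.le hs.le s
  have h2 := hC' s
  rw [pow_one] at h2
  have h3 : (s : ℝ) * r ^ s ≤ s * (2 * C * s.choose (l s)) := by
    calc (s : ℝ) * r ^ s ≤ C * (((s : ℝ) + 1) * s.choose (l s)) :=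
          h2.trans (mul_le_mul_of_nonneg_left hpow hC.le)
      _ ≤ C * ((2 * s) * s.choose (l s)) := by
          have := hpos s
          gcongr; linarith
      _ = s * (2 * C * s.choose (l s)) := by ring
  exact le_of_mul_le_mul_left h3 (by linarith)

/-- The numbers of letters `true` in suitable factors starting an even block have the largest
density as well. -/
lemma exists_even_blockCount_density {β : ℝ}
    (hβ : Tendsto (fun n : ℕ => (maxBlockCount K n : ℝ) / n) atTop (𝓝 β)) :
    ∃ i : ℕ → ℕ, (∀ s, Even (i s)) ∧
      Tendsto (fun s : ℕ => (blockCount K (s - 1) (i s) 0 : ℝ) / s) atTop (𝓝 β) := by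
  have hex : ∀ s : ℕ, ∃ i, Even i ∧ maxBlockCount K (s - 1) ≤ blockCount K (s - 1) i 0 + 2 := by
    intro s
    obtain ⟨i, j, h⟩ := exists_blockCount_eq_max K (s - 1)
    rw [← h]
    exact exists_even_blockCount (s - 1) i j
  choose i hi hcount using hex
  refine ⟨i, hi, ?_⟩
  have hlow : Tendsto (fun s : ℕ => (maxBlockCount K s : ℝ) / s - 3 * (1 / s)) atTop
      (𝓝 (β - 3 * 0)) := hβ.sub (tendsto_one_div_atTop_nhds_zero_nat.const_mul 3)
  rw [mul_zero, sub_zero] at hlow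
  refine tendsto_of_tendsto_of_tendsto_of_le_of_le' hlow hβ ?_ (Eventually.of_forall fun s => ?_)
  · filter_upwards [eventually_gt_atTop 0] with s hs
    have h1 := maxBlockCount_add_le K (s - 1) 1
    rw [Nat.sub_add_cancel hs] at h1
    have h2 : maxBlockCount K 1 ≤ 1 := by
      obtain ⟨i, j, h⟩ := exists_blockCount_eq_max K 1
      exact h ▸ blockCount_le 1 i j
    have h3 : maxBlockCount K s ≤ blockCount K (s - 1) (i s) 0 + 3 := by
      have := hcount s; omega
    have h4 : (maxBlockCount K s : ℝ) ≤ blockCount K (s - 1) (i s) 0 + 3 := by exact_mod_cast h3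
    rw [mul_one_div, ← sub_div]
    gcongr
    linarith
  · have h : blockCount K (s - 1) (i s) 0 ≤ maxBlockCount K s :=
      (blockCount_le_max _ _ _).trans (maxBlockCount_mono K (Nat.sub_le s 1))
    gcongr

end Growth

/-! ### The graded exponents -/

namespace WordAlgebra

variable {F : Type*} [Field F] {K : ℕ → ℕ} {𝒜 : ZMod 2 → Submodule F (WordAlgebra F K)}

lemma gradedCodim_le (hK : ∀ i, 0 < K i) (hfin : ∀ n, (blockFactors K n).Finite)
    (hg : LetterGrading 𝒜) {C r : ℝ}
    (h : ∀ j l, ((j + l).choose l * headBound K j l : ℝ) ≤ C * r ^ (j + l)) (n : ℕ) :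
    (gradedCodim 𝒜 n : ℝ) ≤ C * ((n + 1) * r ^ n) := by
  have hterm : ∀ k ∈ Finset.range (n + 1),
      ((n.choose k * partialCodim 𝒜 k (n - k) : ℕ) : ℝ) ≤ C * r ^ n := by
    intro k hk
    have hk : k ≤ n := Nat.lt_succ_iff.mp (Finset.mem_range.mp hk)
    have h1 := h k (n - k)
    rw [Nat.add_sub_cancel' hk, Nat.choose_symm hk] at h1
    refine le_trans ?_ h1
    exact_mod_cast Nat.mul_le_mul_left _ (partialCodim_le hK hfin hg k (n - k))
  unfold gradedCodim
  rw [Nat.cast_sum]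
  refine (Finset.sum_le_card_nsmul _ _ _ hterm).trans (le_of_eq ?_)
  rw [Finset.card_range, nsmul_eq_mul]
  push_cast
  ring

/-- The binomial theorem turns a bound `r ^ n` for the codimensions of the algebra into a bound
`(1 + r) ^ n` for those of its unital hull. -/
lemma gradedCodim_unitization_le (hK : ∀ i, 0 < K i) (hfin : ∀ n, (blockFactors K n).Finite)
    (hg : LetterGrading 𝒜) {C r : ℝ} (hC : 0 < C) (hr : 0 < r)
    (h : ∀ j l, ((j + l).choose l * headBound K j l : ℝ) ≤ C * r ^ (j + l)) (n : ℕ) :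
    (gradedCodim (unitizationGrading 𝒜) n : ℝ) ≤ (C + 1) * ((n + 1) ^ 2 * (r + 1) ^ n) := by
  have hone : (1 : ℝ) ≤ (r + 1) ^ n := one_le_pow₀ (by linarith)
  have hterm : ∀ k ∈ Finset.range (n + 1),
      ((n.choose k * partialCodim (unitizationGrading 𝒜) k (n - k) : ℕ) : ℝ) ≤
        (C + 1) * ((n + 1) * (r + 1) ^ n) := by
    intro k hk
    have hk : k ≤ n := Nat.lt_succ_iff.mp (Finset.mem_range.mp hk)
    have h1 : n.choose k * partialCodim (unitizationGrading 𝒜) k (n - k) ≤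
        n.choose k * (if n - k = 0 then 1 else 0) +
          ∑ j ∈ Finset.range (k + 1), n.choose k * (k.choose j * headBound K j (n - k)) := by
      rw [← Finset.mul_sum, ← Nat.mul_add]
      exact Nat.mul_le_mul_left _ (partialCodim_unitization_le hK hfin hg k (n - k))
    have h2 : n.choose k * (if n - k = 0 then 1 else 0) ≤ 1 := by
      split_ifs with h0
      · obtain rfl : k = n := by omega
        simp
      · simp
    have h3 : ∀ j ∈ Finset.range (k + 1),
        ((n.choose k * (k.choose j * headBound K j (n - k)) : ℕ) : ℝ) ≤ C * (r + 1) ^ n := by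
      intro j hj
      have hj : j ≤ k := Nat.lt_succ_iff.mp (Finset.mem_range.mp hj)
      have hs : j + (n - k) ≤ n := by omega
      have hmul := Nat.choose_mul (n := n) (Nat.le_add_left (n - k) j)
      rw [Nat.choose_symm hk, Nat.sub_sub_self hk, Nat.add_sub_cancel] at hmul
      have hbin : (n.choose (j + (n - k)) : ℝ) * r ^ (j + (n - k)) ≤ (r + 1) ^ n := by
        have := Finset.single_le_sum
          (f := fun i => r ^ i * 1 ^ (n - i) * (n.choose i : ℝ))
          (fun i _ => by positivity) (Finset.mem_range.mpr (Nat.lt_succ_of_le hs))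
        rw [← add_pow] at this
        simpa [mul_comm] using this
      rw [← mul_assoc, ← hmul]
      push_cast
      calc (n.choose (j + (n - k)) : ℝ) * (j + (n - k)).choose (n - k) * headBound K j (n - k)
          = n.choose (j + (n - k)) *
            ((j + (n - k)).choose (n - k) * headBound K j (n - k)) := by ring
        _ ≤ n.choose (j + (n - k)) * (C * r ^ (j + (n - k))) :=
            mul_le_mul_of_nonneg_left (h j (n - k)) (Nat.cast_nonneg _)
        _ = C * (n.choose (j + (n - k)) * r ^ (j + (n - k))) := by ring
        _ ≤ C * (r + 1) ^ n := by gcongr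
    have h4 := Finset.sum_le_card_nsmul _ _ _ h3
    rw [Finset.card_range, nsmul_eq_mul] at h4
    have hk' : ((k + 1 : ℕ) : ℝ) ≤ n + 1 := by exact_mod_cast Nat.succ_le_succ hk
    have hn0 : (0 : ℝ) ≤ n := Nat.cast_nonneg n
    calc ((n.choose k * partialCodim (unitizationGrading 𝒜) k (n - k) : ℕ) : ℝ)
        ≤ ((n.choose k * (if n - k = 0 then 1 else 0) : ℕ) : ℝ) +
          ∑ j ∈ Finset.range (k + 1),
            ((n.choose k * (k.choose j * headBound K j (n - k)) : ℕ) : ℝ) := by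
          rw [← Nat.cast_sum, ← Nat.cast_add]
          exact Nat.cast_le.mpr h1
      _ ≤ 1 + (n + 1) * (C * (r + 1) ^ n) := by
          refine add_le_add (by exact_mod_cast h2) (h4.trans ?_)
          gcongr
      _ ≤ (n + 1) * (r + 1) ^ n + (n + 1) * (C * (r + 1) ^ n) := by nlinarith
      _ = (C + 1) * ((n + 1) * (r + 1) ^ n) := by ring
  unfold gradedCodim
  rw [Nat.cast_sum]
  refine (Finset.sum_le_card_nsmul _ _ _ hterm).trans (le_of_eq ?_)
  rw [Finset.card_range, nsmul_eq_mul]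
  push_cast
  ring

lemma choose_le_gradedCodim {B : Type*} [NonUnitalNonAssocRing B] [Module F B]
    [IsScalarTower F B B] [SMulCommClass F B B] (ℬ : ZMod 2 → Submodule F B) {n l : ℕ}
    (hl : l ≤ n) : n.choose l * partialCodim ℬ (n - l) l ≤ gradedCodim ℬ n := by
  have h := Finset.single_le_sum (f := fun k => n.choose k * partialCodim ℬ k (n - k))
    (fun _ _ => Nat.zero_le _) (Finset.mem_range.mpr (Nat.lt_succ_of_le (Nat.sub_le n l)))
  rwa [Nat.choose_symm hl, Nat.sub_sub_self hl] at h

/-- Lower bounds for the codimensions: an even first letter followed by the letters along a word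
starting an even block, and, in the unital hull, followed by `n - s` further even letters. -/
lemma choose_le_gradedCodim_of_even (hK : ∀ i, 0 < K i) (hfin : ∀ n, (blockFactors K n).Finite)
    (hg : LetterGrading 𝒜) (ha : ofBasis F .a ∈ 𝒜 0) (hb : ofBasis F .b ∈ 𝒜 1) {i s : ℕ}
    (hz : ofBasis F (.z i ⟨0, hK i⟩) ∈ 𝒜 0) :
    (1 ≤ s → s.choose (blockCount K (s - 1) i 0) ≤ gradedCodim 𝒜 s) ∧
    ∀ n, 2 ≤ s → s ≤ n → n.choose s * s.choose (blockCount K (s - 1) i 0) ≤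
      gradedCodim (unitizationGrading 𝒜) n := by
  have hl := blockCount_le (K := K) (s - 1) i 0
  set l := blockCount K (s - 1) i 0 with hl_def
  refine ⟨fun hs => ?_, fun n hs hn => ?_⟩
  · have h := one_le_partialCodim hK hfin hg ha hb (n := s - 1) (k := s - l) (l := l) hz
      (by omega) rfl
    refine le_trans ?_ (choose_le_gradedCodim 𝒜 (n := s) (l := l) (by omega))
    exact Nat.le_mul_of_pos_right _ h
  · have h := choose_le_partialCodim_unitization hK hfin hg ha hb (n := s - 1) (j := s - l)
      (k := n - l) (l := l) hz (by omega) rfl (by omega)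
    refine le_trans ?_ (choose_le_gradedCodim _ (n := n) (l := l) (by omega))
    rw [Nat.choose_mul (by omega : l ≤ s)]
    exact Nat.mul_le_mul_left _ h

lemma exists_pow_le_of_forall_choose {r C : ℝ} (hr : 1 < r) (hC : 0 < C) {a c : ℕ → ℕ}
    (ha : ∀ s, r ^ s ≤ C * a s) (ha0 : ∀ s, 1 ≤ a s)
    (hc : ∀ n s, 2 ≤ s → s ≤ n → n.choose s * a s ≤ c n) :
    ∃ D, 0 < D ∧ ∀ n, 3 ≤ n → (r + 1) ^ n ≤ D * ((n + 1) * c n) := by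
  refine ⟨C + r, by positivity, fun n hn => ?_⟩
  have hchoose : n ≤ c n := by
    have h1 := hc n 2 le_rfl (by omega)
    have h2 : n ≤ n.choose 2 := by
      rw [Nat.choose_two_right, Nat.le_div_iff_mul_le two_pos]
      exact Nat.mul_le_mul_left n (by omega)
    exact (h2.trans (Nat.le_mul_of_pos_right _ (ha0 2))).trans h1
  have hcn : (n : ℝ) ≤ c n := Nat.cast_le.mpr hchoose
  have hn1 : (1 : ℝ) ≤ n := by exact_mod_cast (by omega : 1 ≤ n)
  have hterm : ∀ s ∈ Finset.range (n + 1),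
      r ^ s * 1 ^ (n - s) * (n.choose s : ℝ) ≤ (C + r) * c n := by
    intro s hs
    have hs : s ≤ n := Nat.lt_succ_iff.mp (Finset.mem_range.mp hs)
    rcases lt_or_ge s 2 with h2 | h2
    · interval_cases s
      · simp; nlinarith
      · simp; nlinarith
    · have h := hc n s h2 hs
      have h' : (n.choose s : ℝ) * a s ≤ c n := by exact_mod_cast h
      rw [one_pow, mul_one]
      calc r ^ s * (n.choose s : ℝ) ≤ C * a s * n.choose s := by gcongr; exact ha s
        _ = C * (n.choose s * a s) := by ring
        _ ≤ C * c n := by gcongr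
        _ ≤ (C + r) * c n := by nlinarith
  have h := Finset.sum_le_card_nsmul _ _ _ hterm
  rw [← add_pow, Finset.card_range, nsmul_eq_mul] at h
  refine h.trans (le_of_eq ?_)
  push_cast
  ring

open Real in
/-- The two exponents, for all words of bounded block lengths and at most linear complexity. -/
lemma exists_gradedExponent (hK : ∀ i, 2 ≤ K i) {c : ℕ} (hc : ∀ i, K i ≤ c)
    (hfin : ∀ n, (blockFactors K n).Finite) {C₀ : ℕ}
    (hC₀ : ∀ n, (blockFactors K n).ncard ≤ C₀ * (n + 1))
    (hg : LetterGrading 𝒜) (ha : ofBasis F .a ∈ 𝒜 0) (hb : ofBasis F .b ∈ 𝒜 1)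
    (hz : ∀ i, Even i → ofBasis F (.z i ⟨0, two_pos.trans_le (hK i)⟩) ∈ 𝒜 0) :
    ∃ e : ℝ, HasGradedExponent 𝒜 e ∧ HasGradedExponent (unitizationGrading 𝒜) (e + 1) := by
  have hK0 : ∀ i, 0 < K i := fun i => two_pos.trans_le (hK i)
  obtain ⟨β, hβ0, hβ1, hβ⟩ := exists_density hK hc
  obtain ⟨i, hi, hiβ⟩ := exists_even_blockCount_density hβ
  have hle : ∀ s, blockCount K (s - 1) (i s) 0 ≤ s := fun s =>
    (blockCount_le _ _ _).trans (Nat.sub_le s 1)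
  have hlow := fun s => choose_le_gradedCodim_of_even hK0 hfin hg ha hb (s := s) (hz _ (hi s))
  have hone : 1 < exp (binEntropy β) :=
    one_lt_exp_iff.mpr (binEntropy_pos hβ0 (by linarith))
  refine ⟨exp (binEntropy β), ?_, ?_⟩
  · refine tendsto_rpow_one_div one_pos hone (fun n => Nat.cast_nonneg _) (fun r hr => ?_)
      fun r hr1 hr => ?_
    · obtain ⟨r', hr', hrr'⟩ := exists_between hr
      obtain ⟨C, hC, h⟩ := exists_choose_mul_headBound_le hC₀ hβ0 hβ1 hβ hr'
      obtain ⟨D, hD, hD'⟩ := exists_const_pow_mul_le 1 ((exp_pos _).trans hr') hrr'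
      refine ⟨2 * (C * D), by positivity, ?_⟩
      filter_upwards [eventually_ge_atTop 1] with n hn
      have hn' : (1 : ℝ) ≤ n := Nat.one_le_cast.mpr hn
      have hr'0 : 0 < r' := (exp_pos _).trans hr'
      have h1 := hD' n
      rw [pow_one] at h1
      calc (gradedCodim 𝒜 n : ℝ) ≤ C * ((n + 1) * r' ^ n) := gradedCodim_le hK0 hfin hg h n
        _ ≤ C * ((2 * n) * r' ^ n) := by gcongr; linarith
        _ = 2 * C * (n * r' ^ n) := by ring
        _ ≤ 2 * C * (D * r ^ n) := mul_le_mul_of_nonneg_left h1 (by positivity)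
        _ = 2 * (C * D) * r ^ n := by ring
    · obtain ⟨C, hC, h⟩ := exists_pow_le_choose hle hiβ (one_pos.trans hr1) hr
      refine ⟨C, hC, ?_⟩
      filter_upwards [eventually_ge_atTop 1] with n hn
      refine (h n).trans ?_
      have := (hlow n).1 hn
      gcongr
  · refine tendsto_rpow_one_div two_pos (by linarith) (fun n => Nat.cast_nonneg _)
      (fun r hr => ?_) fun r hr1 hr => ?_
    · obtain ⟨r₁, hr₁, hr₁r⟩ := exists_between hr
      have hr₁' : exp (binEntropy β) < r₁ - 1 := by linarith
      obtain ⟨C, hC, h⟩ := exists_choose_mul_headBound_le hC₀ hβ0 hβ1 hβ hr₁'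
      have hr₁0 : 0 < r₁ := by linarith
      obtain ⟨D, hD, hD'⟩ := exists_const_pow_mul_le 2 hr₁0 hr₁r
      refine ⟨4 * ((C + 1) * D), by positivity, ?_⟩
      filter_upwards [eventually_ge_atTop 1] with n hn
      have hn' : (1 : ℝ) ≤ n := Nat.one_le_cast.mpr hn
      have h0 := gradedCodim_unitization_le hK0 hfin hg hC (by linarith) h n
      rw [sub_add_cancel] at h0
      calc (gradedCodim (unitizationGrading 𝒜) n : ℝ)
          ≤ (C + 1) * ((n + 1) ^ 2 * r₁ ^ n) := h0
        _ ≤ (C + 1) * ((2 * n) ^ 2 * r₁ ^ n) := by gcongr; linarith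
        _ = 4 * (C + 1) * (n ^ 2 * r₁ ^ n) := by ring
        _ ≤ 4 * (C + 1) * (D * r ^ n) := mul_le_mul_of_nonneg_left (hD' n) (by positivity)
        _ = 4 * ((C + 1) * D) * r ^ n := by ring
    · obtain ⟨r₁, hr₁, hr₁r⟩ := exists_between hr
      have hr₁1 : 1 < r₁ - 1 := by linarith
      obtain ⟨C, hC, h⟩ := exists_pow_le_choose hle hiβ (one_pos.trans hr₁1) (by linarith)
      obtain ⟨D, hD, hD'⟩ := exists_pow_le_of_forall_choose hr₁1 hC h
        (fun s => Nat.choose_pos (hle s)) fun n s => (hlow s).2 n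
      obtain ⟨E, hE, hE'⟩ := exists_const_pow_mul_le 1 (by linarith : 0 < r) hr₁
      refine ⟨2 * (E * D), by positivity, ?_⟩
      filter_upwards [eventually_ge_atTop 3] with n hn
      have hn' : (1 : ℝ) ≤ n := by exact_mod_cast (by omega : 1 ≤ n)
      have h1 := hD' n hn
      rw [sub_add_cancel] at h1
      have h2 := hE' n
      rw [pow_one] at h2
      have h3 : (n : ℝ) * r ^ n ≤
          n * (2 * (E * D) * gradedCodim (unitizationGrading 𝒜) n) := by
        calc (n : ℝ) * r ^ n
            ≤ E * (D * ((n + 1) * gradedCodim (unitizationGrading 𝒜) n)) :=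
              h2.trans (mul_le_mul_of_nonneg_left h1 hE.le)
          _ ≤ E * (D * ((2 * n) * gradedCodim (unitizationGrading 𝒜) n)) := by
              gcongr; linarith
          _ = n * (2 * (E * D) * gradedCodim (unitizationGrading 𝒜) n) := by ring
      exact le_of_mul_le_mul_left h3 (by linarith)

end WordAlgebra

theorem theorem4 {F : Type*} [Field F] [CharZero F] (m : ℕ) (hm : 2 ≤ m) (w : ℕ → Fin 2)
    (hw : IsSturmian w ∨ IsPeriodicWord w)
    (𝒜 : ZMod 2 → Submodule F (BinaryWordAlgebra F m w)) (h𝒜 : IsZ2Grading 𝒜)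
    (hz : WordAlgebra.ofBasis F (K := blockLength m w)
      (WordBasis.z 0 ⟨0, Nat.lt_of_lt_of_le Nat.two_pos (Nat.le_add_right_of_le hm)⟩) ∈ 𝒜 0)
    (ha : WordAlgebra.ofBasis F WordBasis.a ∈ 𝒜 0)
    (hb : WordAlgebra.ofBasis F WordBasis.b ∈ 𝒜 1) :
    ∃ e : ℝ, HasGradedExponent 𝒜 e ∧ HasGradedExponent (unitizationGrading 𝒜) (e + 1) := by
  have hK : ∀ i, 2 ≤ blockLength m w i := fun i => Nat.le_add_right_of_le hm
  have hK0 : ∀ i, 0 < blockLength m w i := fun i => two_pos.trans_le (hK i)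
  have hc : ∀ i, blockLength m w i ≤ m + 1 := fun i =>
    Nat.add_le_add_left (Nat.lt_succ_iff.mp (w i).isLt) m
  obtain ⟨C₀, hC₀⟩ := exists_ncard_blockFactors_le m hw
  refine WordAlgebra.exists_gradedExponent hK hc (finite_blockFactors m w) hC₀
    (WordAlgebra.letterGrading hK0 h𝒜 hz ha hb) ha hb fun i hi => ?_
  have h := WordAlgebra.ofBasis_z_mem hK0 h𝒜 hz ha hb i ⟨0, hK0 i⟩
  rwa [(ZMod.natCast_eq_zero_iff_even).mpr hi] at h
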